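/- Let $p>q$ be prime numbers, let $e$ be the least positive integer with $p^e\equiv 1\pmod q$, let $g\ge 1$ and $n=gq+1$, and assume $p^e>n$ and $p\ge n+q-2$. Write $z=(z_1,\dots,z_n)$. For $s\ge 1$ put $$\Phi_s(t,z)=\big((t-z_1)\cdots(t-z_n)\big)^{(p^{es}-1)/q}\in\mathbb Z[z][t],$$ let $A(\Phi_s)$ be the $g\times g$ matrix with entries in $\mathbb Z[z]$ whose $(u,v)$ entry, $1\le u,v\le g$, is the coefficient of $t^{p^{es}v-u}$ in $\Phi_s$, and let $I_s$ be the $n\times g$ matrix with entries in $\mathbb Z[z]$ whose $(j,\ell)$ entry, $1\le j\le n$, $1\le \ell\le g$, is the coefficient of $t^{\ell p^{es}-1}$ in $\Phi_s(t,z)/(t-z_j)$. Let $m\ge 1$, let $\mathbb Q_p^{(m)}$ be the unramified extension of $\mathbb Q_p$ of degree $m$ in a fixed algebraic closure, with the norm $|\cdot|_p$ extending the $p$-adic norm, and let $\mathbb Z_p^{(m)}=\{x\in\mathbb Q_p^{(m)}: |x|_p\le 1\}$. Let $$\mathfrak D^{(m)}_{KZ}=\{a\in(\mathbb Z_p^{(m)})^n:\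 |\det A(\Phi_1)(a)|_p=1\},$$ which is a union of open unit polydiscs $\{z : |z_j-a_j|_p<1,\ j=1,\dots,n\}$. A function on $\mathfrak D^{(m)}_{KZ}$ is called analytic if on each of these polydiscs it is given by a convergent power series. Then $|\det A(\Phi_s)(a)|_p=1$ for all $s\ge1$ and $a\in\mathfrak D^{(m)}_{KZ}$, so that the entries of the matrices below are rational functions of $z$ regular on $\mathfrak D^{(m)}_{KZ}$. For every $i=1,\dots,n$ the sequences $$\Big(\frac{\partial A(\Phi_s)}{\partial z_i}\cdot A(\Phi_s)^{-1}\Big)_{s\ge1},\qquad \big(I_s\cdot A(\Phi_s)^{-1}\big)_{s\ge1},\qquad \Big(\frac{\partial I_s}{\partial z_i}\cdot A(\Phi_s)^{-1}\Big)_{s\ge1}$$ converge uniformly on $\mathfrak D^{(m)}_{KZ}$, as $s\to\infty$, to analytic matrix-valued functions $\mathcal A^{(i)}$ (of size $g\times g$), $\mathcal I$ and $\mathcal I^{(i)}$ (of size $n\times g$) respectively, and on $\mathfrak D^{(m)}_{KZ}$ $$\frac{\partial \mathcal I}{\partial z_i}=\mathcal I^{(i)}-\mathcal I\cdot\mathcal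 A^{(i)}\qquad (i=1,\dots,n).$$ -/

import Mathlib

noncomputable section

namespace KZ

open Polynomial

/-- The unramified extension of degree `m ≥ 1` of `ℚ_[p]` inside the algebraic closure
`PadicAlgCl p` (whose norm extends the `p`-adic norm): it is obtained by attaching
a primitive root of unity of order `p ^ m - 1`. -/
def unramifiedExt (p : ℕ) [Fact p.Prime] (m : ℕ) : IntermediateField ℚ_[p] (PadicAlgCl p) :=
  IntermediateField.adjoin ℚ_[p] {ζ : PadicAlgCl p | IsPrimitiveRoot ζ (p ^ m - 1)}

/-- The master polynomial `Φ_s(t, z) = ((t - z_1) ⋯ (t - z_n)) ^ ((p ^ (e s) - 1) / q)`,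
as a polynomial in `t` with coefficients in `ℤ[z_1, …, z_n]`. -/
def masterPoly (n p q e s : ℕ) : (MvPolynomial (Fin n) ℤ)[X] :=
  (∏ i : Fin n, (X - C (MvPolynomial.X i))) ^ ((p ^ (e * s) - 1) / q)

/-- The Hasse--Witt matrix `A(Φ_s) = (Coeff_{p ^ (e s) v - u} Φ_s)`, `u, v = 1, …, g`.
The indices `u, v : Fin g` stand for `u + 1, v + 1`; for `g ≤ p ^ (e s)` the subtraction
does not truncate. -/
def hasseWitt (n g p q e s : ℕ) : Matrix (Fin g) (Fin g) (MvPolynomial (Fin n) ℤ) :=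
  Matrix.of fun u v =>
    (masterPoly n p q e s).coeff (p ^ (e * s) * ((v : ℕ) + 1) - ((u : ℕ) + 1))

/-- The `n × g` matrix `I_s`: the entry in row `i` and column `ℓ = 1, …, g` is the coefficient of
`t ^ (ℓ p ^ (e s) - 1)` in the polynomial `Φ_s(t, z) / (t - z_i)`. The index `l : Fin g`
stands for `ℓ = l + 1`. -/
def solMatrix (n g p q e s : ℕ) : Matrix (Fin n) (Fin g) (MvPolynomial (Fin n) ℤ) :=
  Matrix.of fun i l =>
    (masterPoly n p q e s /ₘ (X - C (MvPolynomial.X i))).coeff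
      (((l : ℕ) + 1) * p ^ (e * s) - 1)

/-- For `s ≥ 1` (that is, for a positive exponent) the division in `solMatrix` is exact. -/
theorem masterPoly_div_mul (n p q e s : ℕ) (h : 0 < (p ^ (e * s) - 1) / q) (i : Fin n) :
    (X - C (MvPolynomial.X i)) * (masterPoly n p q e s /ₘ (X - C (MvPolynomial.X i))) =
      masterPoly n p q e s := by
  rw [mul_divByMonic_eq_iff_isRoot, IsRoot.def, masterPoly, eval_pow, eval_prod,
    Finset.prod_eq_zero (Finset.mem_univ i) (by simp), zero_pow h.ne']

/-- The entrywise partial derivative `∂ / ∂ z_i` of a matrix of polynomials in `z`. -/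
def matPDeriv {n : ℕ} {ι κ : Type} (i : Fin n) (M : Matrix ι κ (MvPolynomial (Fin n) ℤ)) :
    Matrix ι κ (MvPolynomial (Fin n) ℤ) :=
  M.map (MvPolynomial.pderiv i)

/-- The value at the point `a` of a matrix of polynomials in `z`. -/
def matEval {n : ℕ} {ι κ K : Type} [Field K] (M : Matrix ι κ (MvPolynomial (Fin n) ℤ))
    (a : Fin n → K) : Matrix ι κ K :=
  M.map (MvPolynomial.aeval a)

/-- The domain of points `a` with coordinates in the ring of integers of `unramifiedExt p m`
such that `|det A(Φ_1)(a)| = 1`. -/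
def domain (n g p q e m : ℕ) [Fact p.Prime] : Set (Fin n → unramifiedExt p m) :=
  {a | (∀ j, ‖a j‖ ≤ 1) ∧ ‖(matEval (hasseWitt n g p q e 1) a).det‖ = 1}

/-- A matrix function is analytic on a set `D` of points that is a union of open unit polydiscs:
on each of these polydiscs, which are the balls of radius `1` for the sup norm
with a centre in `D`, each entry is the sum of a convergent power series. -/
def AnalyticOnUnitPolydiscs {n : ℕ} {ι κ K : Type} [NontriviallyNormedField K]
    (D : Set (Fin n → K)) (F : (Fin n → K) → Matrix ι κ K) : Prop :=
  ∀ a ∈ D, ∀ k l, ∃ P : FormalMultilinearSeries K (Fin n → K) K,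
    HasFPowerSeriesOnBall (fun z => F z k l) P a 1

end KZ

end

/-!
Write `P = p ^ e` and `F = Φ_1`. Then `Φ_s = F ^ (1 + P + ⋯ + P ^ (s - 1))`, and up to an integer
factor with a `p`-adic limit every row of the matrices of the theorem consists of the coefficients
of `E F ^ (P + ⋯ + P ^ (s - 1))` at the multiples of `P ^ s`, for a polynomial `E` of small degree
that does not depend on `s`. Since `G ^ p ^ (k + 1)` is congruent modulo `p ^ (k + 1)` to the value
of `G ^ p ^ k` at `t ^ p` with twisted coefficients, Dwork's congruences follow: in the basis of
the rows of `A(Φ_s)`, the coordinates of such a vector change by a multiple of `p ^ s` when `s`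
increases by one.

The argument works in any ring that is complete for the `p`-adic topology. In the ring of integers
`𝒪` it gives uniform convergence; in `𝒪⟦x_1, …, x_n⟧`, at the generic point `a + x` of
a polydisc, it gives a limit with power series entries, of which the limit at each point of
the polydisc is a specialization. Finally, the first-order Taylor remainder of `I_s A(Φ_s)⁻¹` at
an integral increment `t` is at most `|t| ^ 2` for every `s`, so that this bound passes to the limit
and gives the derivative.
-/

noncomputable section

namespace KZ

open Polynomial
open scoped Matrix

section Congruences

variable {R : Type*} [CommRing R]

theorem natCast_dvd_mul_coeff_pow (G : R[X]) (N k : ℕ) :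
    (N : R) ∣ k * (G ^ N).coeff k := by
  rcases k with _ | k
  · simp
  · have h := coeff_derivative (G ^ N) k
    rw [derivative_pow, mul_assoc, coeff_C_mul] at h
    exact ⟨_, by rw [h]; push_cast; ring⟩

theorem prime_pow_dvd_coeff_pow {p : ℕ} (hp : p.Prime) (hreg : IsLeftRegular (p : R)) (G : R[X])
    (a : ℕ) {c k : ℕ} (hk : ¬ p ^ (c + 1) ∣ k) : (p : R) ^ (a - c) ∣ (G ^ p ^ a).coeff k := by
  obtain ⟨d, k', hk', rfl⟩ :=
    Nat.exists_eq_pow_mul_and_not_dvd (n := k) (by rintro rfl; simp at hk) p hp.ne_one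
  have hdc : d ≤ c := by
    by_contra! hcd
    exact hk ((pow_dvd_pow p hcd).mul_right k')
  have hcop : IsCoprime ((p : R) ^ (a - c)) (k' : R) :=
    (((Nat.Prime.coprime_iff_not_dvd hp).2 hk').cast (R := R)).pow_left
  refine hcop.dvd_of_dvd_mul_left ?_
  rcases le_total a c with hac | hca
  · simp [Nat.sub_eq_zero_of_le hac]
  obtain ⟨x, hx⟩ := natCast_dvd_mul_coeff_pow G (p ^ a) (p ^ d * k')
  have hcancel : (k' : R) * (G ^ p ^ a).coeff (p ^ d * k') = (p : R) ^ (a - d) * x := by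
    apply hreg.pow d
    simp only
    rw [← mul_assoc, ← mul_assoc, ← pow_add, Nat.add_sub_cancel' (hdc.trans hca)]
    exact_mod_cast hx
  rw [hcancel]
  exact (pow_dvd_pow _ (Nat.sub_le_sub_left hdc a)).mul_right x

theorem exists_pow_dvd_and_dvd_coeff_pow {p e : ℕ} (hp : p.Prime) (he : 0 < e)
    (hreg : IsLeftRegular (p : R)) (G : R[X]) (s k : ℕ) :
    ∃ b ≤ s, (p ^ e) ^ b ∣ k ∧ (p : R) ^ (s - b) ∣ (G ^ (p ^ e) ^ s).coeff k := by
  obtain ⟨b, hbs, hbk, hmax⟩ : ∃ b ≤ s, (p ^ e) ^ b ∣ k ∧ (b < s → ¬ (p ^ e) ^ (b + 1) ∣ k) := by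
    classical
    have hbs : Nat.findGreatest (fun b => (p ^ e) ^ b ∣ k) s ≤ s := Nat.findGreatest_le s
    exact ⟨_, hbs, Nat.findGreatest_spec (P := fun b => (p ^ e) ^ b ∣ k) s.zero_le (by simp),
      fun h => Nat.findGreatest_is_greatest (P := fun b => (p ^ e) ^ b ∣ k) (Nat.lt_succ_self _) h⟩
  refine ⟨b, hbs, hbk, ?_⟩
  rcases hbs.eq_or_lt with rfl | hlt
  · simp
  have hnext := hmax hlt
  obtain ⟨r, rfl⟩ := Nat.exists_eq_add_of_lt hlt
  obtain ⟨c, hc⟩ : ∃ c, e * (b + 1) = c + 1 := Nat.exists_eq_succ_of_ne_zero (by positivity)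
  rw [← pow_mul, hc] at hnext
  have h := prime_pow_dvd_coeff_pow hp hreg G (e * (b + r + 1)) hnext
  rw [← pow_mul]
  refine (pow_dvd_pow _ ?_).trans h
  have : r ≤ e * r := Nat.le_mul_of_pos_left r he
  have : e * (b + r + 1) = c + 1 + e * r := by rw [← hc]; ring
  omega

end Congruences

/-- The exponent `P + P² + ⋯ + P ^ (s - 1)`, so that `F ^ (1 + geomTail P s)` is the product of
the `F ^ P ^ i` with `i < s`. -/
def geomTail (P s : ℕ) : ℕ := ∑ i ∈ Finset.Ico 1 s, P ^ i

theorem geomTail_one (P : ℕ) : geomTail P 1 = 0 := by simp [geomTail]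

theorem geomTail_succ (P : ℕ) {s : ℕ} (hs : 1 ≤ s) :
    geomTail P (s + 1) = geomTail P s + P ^ s :=
  Finset.sum_Ico_succ_top hs _

theorem geomTail_eq_add_pow_mul (P : ℕ) {b s : ℕ} (hb : 1 ≤ b) (hbs : b ≤ s) :
    geomTail P s = geomTail P b + (∑ i ∈ Finset.range (s - b), P ^ i) * P ^ b := by
  rw [geomTail, ← Finset.sum_Ico_consecutive _ hb hbs, Finset.sum_Ico_eq_sum_range _ b s,
    Finset.sum_mul]
  simp only [geomTail, pow_add, mul_comm]

section CoeffMatrix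

variable {R : Type*} [CommRing R]

/-- The coefficients of `E F ^ (P + ⋯ + P ^ (s - 1))` at `P ^ s, 2 P ^ s, …, g P ^ s`. All the
matrices of the theorem are, up to an integer factor, made of rows of this shape. -/
def coeffVec (F : R[X]) (P g s : ℕ) (E : R[X]) : Fin g → R :=
  fun v => (E * F ^ geomTail P s).coeff (P ^ s * ((v : ℕ) + 1))

/-- The matrix whose rows are the coefficient vectors of `t F, t ^ 2 F, …, t ^ g F`; it is
the Hasse--Witt matrix of level `s` when `F` is the master polynomial of level `1`. -/
def coeffMatrix (F : R[X]) (P g s : ℕ) : Matrix (Fin g) (Fin g) R :=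
  Matrix.of fun u => coeffVec F P g s (X ^ ((u : ℕ) + 1) * F)

/-- The coordinates of `coeffVec` in the basis of the rows of `coeffMatrix`; Dwork congruences
compare these for consecutive `s`. -/
def normalizedCoeffVec (F : R[X]) (P g s : ℕ) (E : R[X]) : Fin g → R :=
  coeffVec F P g s E ᵥ* (coeffMatrix F P g s)⁻¹

/-- The condition on `E` under which the coefficients of `E F ^ (P + ⋯ + P ^ (s - 1))` at
multiples of `P ^ s` vanish outside of the range covered by `coeffVec`. -/
structure IsAdmissible (P g : ℕ) (E : R[X]) : Prop where
  coeff_zero : E.coeff 0 = 0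
  natDegree_lt : E.natDegree < (g + 1) * P

theorem isAdmissible_X_pow_mul {P g u : ℕ} (hP : 0 < P) (hu : u < g) {H : R[X]}
    (hH : H.natDegree ≤ (g + 1) * (P - 1)) : IsAdmissible P g (X ^ (u + 1) * H) where
  coeff_zero := by simp
  natDegree_lt := by
    obtain ⟨Q, rfl⟩ := Nat.exists_eq_succ_of_ne_zero hP.ne'
    have hX := natDegree_X_pow_le (R := R) (u + 1)
    have hmul := natDegree_mul_le (p := X ^ (u + 1)) (q := H)
    rw [Nat.succ_sub_one] at hH
    rw [Nat.succ_eq_add_one, Nat.mul_succ]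
    omega

theorem IsAdmissible.map {S : Type*} [CommRing S] {P g : ℕ} {E : R[X]} (h : IsAdmissible P g E)
    (φ : R →+* S) : IsAdmissible P g (E.map φ) where
  coeff_zero := by rw [coeff_map, h.coeff_zero, map_zero]
  natDegree_lt := natDegree_map_le.trans_lt h.natDegree_lt

theorem natDegree_mul_pow_geomTail_lt {F E : R[X]} {P g s : ℕ} (hP : 0 < P) (hs : 1 ≤ s)
    (hF : F.natDegree ≤ (g + 1) * (P - 1)) (hE : E.natDegree < (g + 1) * P) :
    (E * F ^ geomTail P s).natDegree < (g + 1) * P ^ s := by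
  induction s, hs using Nat.le_induction with
  | base => simpa [geomTail_one] using hE
  | succ s hs ih =>
    obtain ⟨Q, rfl⟩ := Nat.exists_eq_succ_of_ne_zero hP.ne'
    rw [Nat.succ_sub_one] at hF
    rw [geomTail_succ _ hs, pow_add, ← mul_assoc]
    calc _ ≤ (E * F ^ geomTail Q.succ s).natDegree + (F ^ Q.succ ^ s).natDegree :=
          natDegree_mul_le
      _ < (g + 1) * Q.succ ^ s + Q.succ ^ s * ((g + 1) * Q) :=
          add_lt_add_of_lt_of_le ih (natDegree_pow_le.trans (Nat.mul_le_mul_left _ hF))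
      _ = (g + 1) * Q.succ ^ (s + 1) := by rw [Nat.succ_eq_add_one]; ring

theorem coeff_mul_pow_geomTail {F E : R[X]} {P g s : ℕ} (hP : 0 < P) (hs : 1 ≤ s)
    (hF : F.natDegree ≤ (g + 1) * (P - 1)) (hE : IsAdmissible P g E) (w : ℕ) :
    (E * F ^ geomTail P s).coeff (P ^ s * w) =
      coeffVec F P g s E ⬝ᵥ fun v => if (v : ℕ) + 1 = w then 1 else 0 := by
  simp only [dotProduct, mul_ite, mul_one, mul_zero]
  rcases w with _ | w
  · simp [mul_coeff_zero, hE.coeff_zero]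
  by_cases hw : w < g
  · rw [Finset.sum_eq_single_of_mem (⟨w, hw⟩ : Fin g) (Finset.mem_univ _)]
    · simp [coeffVec]
    · exact fun v _ hv => if_neg fun h => hv (Fin.ext (by simpa using h))
  · rw [Finset.sum_eq_zero fun v _ => if_neg (by omega)]
    refine coeff_eq_zero_of_natDegree_lt
      ((natDegree_mul_pow_geomTail_lt hP hs hF hE.natDegree_lt).trans_le ?_)
    rw [mul_comm]
    exact Nat.mul_le_mul_left _ (by omega)

variable {S : Type*} [CommRing S] (φ : R →+* S)

theorem map_coeffVec (F : R[X]) (P g s : ℕ) (E : R[X]) :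
    φ ∘ coeffVec F P g s E = coeffVec (F.map φ) P g s (E.map φ) := by
  funext v
  simp only [Function.comp_apply, coeffVec, ← coeff_map, Polynomial.map_mul, Polynomial.map_pow]

theorem map_coeffMatrix (F : R[X]) (P g s : ℕ) :
    (coeffMatrix F P g s).map φ = coeffMatrix (F.map φ) P g s := by
  ext u v
  have h := congrFun (map_coeffVec φ F P g s (X ^ ((u : ℕ) + 1) * F)) v
  rwa [Polynomial.map_mul, Polynomial.map_pow, map_X] at h

theorem map_det_coeffMatrix (F : R[X]) (P g s : ℕ) :
    φ (coeffMatrix F P g s).det = (coeffMatrix (F.map φ) P g s).det := by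
  rw [RingHom.map_det, RingHom.mapMatrix_apply, map_coeffMatrix]

end CoeffMatrix

section DworkCongruence

variable {R : Type*} [CommRing R] {F : R[X]} {P g s t : ℕ}

/-- Modulo `d`, the value `f E` at an admissible `E` is a fixed linear combination of the entries
of `coeffVec F P g s E`. -/
def IsCombinationMod (d : R) (F : R[X]) (P g s : ℕ) (f : R[X] → R) : Prop :=
  ∃ x : Fin g → R, ∀ E, IsAdmissible P g E → d ∣ f E - coeffVec F P g s E ⬝ᵥ x

theorem dvd_dotProduct {ι : Type*} [Fintype ι] {d : R} {a : ι → R} (h : ∀ i, d ∣ a i)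
    (b : ι → R) : d ∣ a ⬝ᵥ b :=
  Finset.dvd_sum fun i _ => (h i).mul_right _

namespace IsCombinationMod

theorem of_dvd {d : R} {f : R[X] → R} (h : ∀ E, d ∣ f E) : IsCombinationMod d F P g s f :=
  ⟨0, fun E _ => by simpa using h E⟩

theorem of_dvd_mul {c d d' : R} {f : R[X] → R} (h : IsCombinationMod d F P g s f)
    (hd : d' ∣ c * d) : IsCombinationMod d' F P g s fun E => f E * c := by
  obtain ⟨x, hx⟩ := h
  refine ⟨c • x, fun E hE => ?_⟩
  have h := hd.trans (mul_dvd_mul_left c (hx E hE))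
  rwa [mul_sub, mul_comm c (f E), ← smul_eq_mul c (_ ⬝ᵥ _), ← dotProduct_smul] at h

theorem sum {d : R} {ι : Type*} {I : Finset ι} {f : ι → R[X] → R}
    (h : ∀ i ∈ I, IsCombinationMod d F P g s (f i)) :
    IsCombinationMod d F P g s fun E => ∑ i ∈ I, f i E := by
  choose! x hx using h
  refine ⟨∑ i ∈ I, x i, fun E hE => ?_⟩
  rw [dotProduct_sum, ← Finset.sum_sub_distrib]
  exact Finset.dvd_sum fun i hi => hx i hi E hE

end IsCombinationMod

theorem dvd_normalizedCoeffVec_sub {d : R} (hP : 0 < P) (hF : F.natDegree ≤ (g + 1) * (P - 1))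
    (hs : IsUnit (coeffMatrix F P g s).det) (ht : IsUnit (coeffMatrix F P g t).det)
    (h : ∀ v, IsCombinationMod d F P g s fun E => coeffVec F P g t E v)
    {E : R[X]} (hE : IsAdmissible P g E) (v : Fin g) :
    d ∣ normalizedCoeffVec F P g t E v - normalizedCoeffVec F P g s E v := by
  choose x hx using h
  set L := normalizedCoeffVec F P g s E with hL
  have hLs : L ᵥ* coeffMatrix F P g s = coeffVec F P g s E := by
    rw [hL, normalizedCoeffVec, Matrix.vecMul_vecMul, Matrix.nonsing_inv_mul _ hs,
      Matrix.vecMul_one]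
  have hLt (w : Fin g) : d ∣ (coeffVec F P g t E - L ᵥ* coeffMatrix F P g t) w := by
    have hsum : (coeffVec F P g t E - L ᵥ* coeffMatrix F P g t) w =
        (coeffVec F P g t E w - coeffVec F P g s E ⬝ᵥ x w) -
          (fun u => coeffMatrix F P g t u w - coeffMatrix F P g s u ⬝ᵥ x w) ⬝ᵥ L := by
      rw [← hLs, ← Matrix.dotProduct_mulVec, dotProduct_comm _ L]
      exact (sub_sub_sub_cancel_right _ _ _).symm.trans
        (congrArg _ (dotProduct_sub L (fun u => coeffMatrix F P g t u w) _).symm)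
    rw [hsum]
    exact dvd_sub (hx w E hE) (dvd_dotProduct (fun u =>
      hx w _ (isAdmissible_X_pow_mul hP u.2 hF)) L)
  have hsub : normalizedCoeffVec F P g t E - L =
      (coeffVec F P g t E - L ᵥ* coeffMatrix F P g t) ᵥ* (coeffMatrix F P g t)⁻¹ := by
    rw [Matrix.sub_vecMul, Matrix.vecMul_vecMul, Matrix.mul_nonsing_inv _ ht, Matrix.vecMul_one]
    rfl
  rw [← Pi.sub_apply, hsub]
  exact dvd_dotProduct hLt _

variable {p e : ℕ}

/-- Dwork's mechanism in a form suited to induction: twisting by a `p ^ (e s)`-th power does not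
leave the span of `coeffVec` modulo `p ^ s`. -/
def TwistIsCombination (p P g : ℕ) (F : R[X]) (s : ℕ) : Prop :=
  ∀ (G : R[X]) (w : ℕ), IsCombinationMod ((p : R) ^ s) F P g s
    fun E => (E * F ^ geomTail P s * G ^ P ^ s).coeff (P ^ s * w)

theorem TwistIsCombination.coeffVec_succ (h : TwistIsCombination p P g F s) (hs : 1 ≤ s)
    (v : Fin g) :
    IsCombinationMod ((p : R) ^ s) F P g s fun E => coeffVec F P g (s + 1) E v := by
  simpa only [coeffVec, geomTail_succ P hs, pow_add, pow_succ, mul_assoc] using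
    h F (P * ((v : ℕ) + 1))

theorem TwistIsCombination.dvd_normalizedCoeffVec_sub {b : ℕ} (hP : 0 < P)
    (hF : F.natDegree ≤ (g + 1) * (P - 1))
    (hA : ∀ i, 1 ≤ i → IsUnit (coeffMatrix F P g i).det) (hb : 1 ≤ b) (hbs : b ≤ s)
    (h : ∀ i < s, b ≤ i → TwistIsCombination p P g F i)
    {E : R[X]} (hE : IsAdmissible P g E) (v : Fin g) :
    (p : R) ^ b ∣ normalizedCoeffVec F P g s E v - normalizedCoeffVec F P g b E v := by
  induction s, hbs using Nat.le_induction with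
  | base => simp
  | succ s hbs ih =>
    have hs := hb.trans hbs
    have hstep := KZ.dvd_normalizedCoeffVec_sub hP hF (hA s hs) (hA (s + 1) (by omega))
      ((h s s.lt_succ_self hbs).coeffVec_succ hs) hE v
    have hprev := ih fun i hi => h i (hi.trans s.lt_succ_self)
    simpa using dvd_add ((pow_dvd_pow _ hbs).trans hstep) hprev

theorem IsCombinationMod.of_normalizedCoeffVec {d : R} {b : ℕ} {f : R[X] → R}
    (hb : IsUnit (coeffMatrix F P g b).det) (h : IsCombinationMod d F P g b f)
    (hd : ∀ E, IsAdmissible P g E → ∀ v,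
      d ∣ normalizedCoeffVec F P g s E v - normalizedCoeffVec F P g b E v) :
    IsCombinationMod d F P g s f := by
  obtain ⟨x, hx⟩ := h
  set y := coeffMatrix F P g b *ᵥ x with hy
  refine ⟨(coeffMatrix F P g s)⁻¹ *ᵥ y, fun E hE => ?_⟩
  have hEb : coeffVec F P g b E ⬝ᵥ x = normalizedCoeffVec F P g b E ⬝ᵥ y := by
    rw [hy, normalizedCoeffVec, ← Matrix.dotProduct_mulVec, Matrix.mulVec_mulVec,
      Matrix.nonsing_inv_mul _ hb, Matrix.one_mulVec]
  have hEs : coeffVec F P g s E ⬝ᵥ (coeffMatrix F P g s)⁻¹ *ᵥ y =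
      normalizedCoeffVec F P g s E ⬝ᵥ y := Matrix.dotProduct_mulVec _ _ _
  have hdiff : d ∣ (normalizedCoeffVec F P g s E - normalizedCoeffVec F P g b E) ⬝ᵥ y :=
    dvd_dotProduct (hd E hE) y
  rw [sub_dotProduct, ← hEs, ← hEb] at hdiff
  simpa using dvd_sub (hx E hE) hdiff

theorem twistIsCombination (hp : p.Prime) (he : 0 < e) (hreg : IsLeftRegular (p : R))
    (hF : F.natDegree ≤ (g + 1) * (p ^ e - 1))
    (hA : ∀ b, 1 ≤ b → IsUnit (coeffMatrix F (p ^ e) g b).det) (s : ℕ) :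
    TwistIsCombination p (p ^ e) g F s := by
  have hP : 0 < p ^ e := pow_pos hp.pos e
  induction s using Nat.strong_induction_on with
  | _ s ih =>
  intro G w
  rcases Nat.eq_zero_or_pos s with rfl | hs
  · exact .of_dvd fun E => by simp
  simp only [coeff_mul _ (G ^ (p ^ e) ^ s)]
  refine .sum fun ⟨i, k⟩ hik => ?_
  rw [Finset.HasAntidiagonal.mem_antidiagonal] at hik
  obtain ⟨b, hbs, hbk, hdvd⟩ := exists_pow_dvd_and_dvd_coeff_pow hp he hreg G s k
  obtain ⟨w', rfl⟩ : (p ^ e) ^ b ∣ i :=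
    (Nat.dvd_add_left hbk).1 (hik ▸ (pow_dvd_pow _ hbs).mul_right w)
  suffices IsCombinationMod ((p : R) ^ b) F (p ^ e) g s
      fun E => (E * F ^ geomTail (p ^ e) s).coeff ((p ^ e) ^ b * w') from
    this.of_dvd_mul (by simpa [← pow_add, hbs] using mul_dvd_mul_right hdvd ((p : R) ^ b))
  rcases hbs.eq_or_lt with rfl | hlt
  · exact ⟨_, fun E hE => (sub_eq_zero_of_eq (coeff_mul_pow_geomTail hP hs hF hE w')) ▸ dvd_zero _⟩
  rcases Nat.eq_zero_or_pos b with rfl | hb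
  · exact .of_dvd fun E => by simp
  refine .of_normalizedCoeffVec (hA b hb) ?_ fun E hE v =>
    TwistIsCombination.dvd_normalizedCoeffVec_sub hP hF hA hb hbs (fun i hi _ => ih i hi) hE v
  simpa only [geomTail_eq_add_pow_mul (p ^ e) hb hbs, pow_add, pow_mul, mul_assoc] using
    ih b hlt (F ^ ∑ i ∈ Finset.range (s - b), (p ^ e) ^ i) w'

theorem pow_dvd_normalizedCoeffVec_succ_sub (hp : p.Prime) (he : 0 < e)
    (hreg : IsLeftRegular (p : R)) (hF : F.natDegree ≤ (g + 1) * (p ^ e - 1))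
    (hA : ∀ b, 1 ≤ b → IsUnit (coeffMatrix F (p ^ e) g b).det)
    {E : R[X]} (hE : IsAdmissible (p ^ e) g E) (s : ℕ) (v : Fin g) :
    (p : R) ^ s ∣ normalizedCoeffVec F (p ^ e) g (s + 1) E v -
      normalizedCoeffVec F (p ^ e) g s E v := by
  rcases Nat.eq_zero_or_pos s with rfl | hs
  · simp
  · exact TwistIsCombination.dvd_normalizedCoeffVec_sub (pow_pos hp.pos e) hF hA hs s.le_succ
      (fun i _ _ => twistIsCombination hp he hreg hF hA i) hE v

end DworkCongruence

section UnitDeterminant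

variable {R : Type*} [CommRing R] {p e g s : ℕ}

theorem contract_mul_pow_geomTail {F E : R[X]} {P : ℕ} (hP : 0 < P) (hs : 1 ≤ s)
    (hF : F.natDegree ≤ (g + 1) * (P - 1)) (hE : IsAdmissible P g E) :
    contract (P ^ s) (E * F ^ geomTail P s) =
      ∑ w : Fin g, C (coeffVec F P g s E w) * X ^ ((w : ℕ) + 1) := by
  ext k
  rw [coeff_contract (pow_pos hP s).ne', mul_comm k, coeff_mul_pow_geomTail hP hs hF hE,
    finsetSum_coeff]
  simp only [dotProduct, coeff_C_mul_X_pow, mul_ite, mul_one, mul_zero, eq_comm]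

theorem coeffMatrix_succ_charP [Fact p.Prime] [CharP R p] (hs : 1 ≤ s) (F : R[X])
    (hF : F.natDegree ≤ (g + 1) * (p ^ e - 1)) :
    coeffMatrix F (p ^ e) g (s + 1) = coeffMatrix F (p ^ e) g s *
      coeffMatrix (F.map (iterateFrobenius R p (e * s))) (p ^ e) g 1 := by
  have hP : 0 < p ^ e := pow_pos (Fact.out : p.Prime).pos e
  have hPs : (p ^ e) ^ s ≠ 0 := (pow_pos hP s).ne'
  have hfrob : F ^ (p ^ e) ^ s =
      expand R ((p ^ e) ^ s) (F.map (iterateFrobenius R p (e * s))) := by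
    rw [← pow_mul, ← map_iterateFrobenius_expand, map_expand]
  ext u v
  set E := X ^ ((u : ℕ) + 1) * F with hE
  have hadm : IsAdmissible (p ^ e) g E := isAdmissible_X_pow_mul hP u.2 hF
  calc coeffVec F (p ^ e) g (s + 1) E v
      = (E * F ^ geomTail (p ^ e) s * F ^ (p ^ e) ^ s).coeff
          (p ^ e * ((v : ℕ) + 1) * (p ^ e) ^ s) := by
        rw [coeffVec, geomTail_succ _ hs, pow_add, ← mul_assoc]
        congr 1
        ring
    _ = ((∑ w : Fin g, C (coeffVec F (p ^ e) g s E w) * X ^ ((w : ℕ) + 1)) *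
          F.map (iterateFrobenius R p (e * s))).coeff (p ^ e * ((v : ℕ) + 1)) := by
        rw [hfrob, ← coeff_contract hPs, contract_mul_expand hPs,
          contract_mul_pow_geomTail hP hs hF hadm]
    _ = _ := by
        rw [Finset.sum_mul, finsetSum_coeff, Matrix.mul_apply]
        refine Finset.sum_congr rfl fun w _ => ?_
        rw [mul_assoc, coeff_C_mul]
        simp [coeffMatrix, coeffVec, geomTail_one, hE]

theorem isUnit_det_coeffMatrix (hp : p.Prime)
    (hjac : Ideal.span {(p : R)} ≤ Ideal.jacobson ⊥) {F : R[X]}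
    (hF : F.natDegree ≤ (g + 1) * (p ^ e - 1))
    (hA : IsUnit (coeffMatrix F (p ^ e) g 1).det) (hs : 1 ≤ s) :
    IsUnit (coeffMatrix F (p ^ e) g s).det := by
  rcases subsingleton_or_nontrivial R with hR | hR
  · exact isUnit_of_subsingleton _
  have : Fact p.Prime := ⟨hp⟩
  have hp_nonunit : (p : R) ∈ nonunits R := fun hu => by
    obtain ⟨x, hx⟩ := hu.exists_right_inv
    have h := Ideal.mem_jacobson_bot.1 (hjac (Ideal.mem_span_singleton_self _)) (-x)
    rw [mul_neg, hx, neg_add_cancel] at h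
    exact not_isUnit_zero h
  have : CharP (R ⧸ Ideal.span {(p : R)}) p := CharP.quotient R p hp_nonunit
  have := isLocalHom_of_le_jacobson_bot _ hjac
  induction s, hs using Nat.le_induction with
  | base => exact hA
  | succ s hs ih =>
    refine isUnit_of_map_unit (Ideal.Quotient.mk (Ideal.span {(p : R)})) _ ?_
    rw [map_det_coeffMatrix, coeffMatrix_succ_charP hs _ (natDegree_map_le.trans hF),
      Matrix.det_mul, ← map_det_coeffMatrix, ← map_det_coeffMatrix, ← map_det_coeffMatrix]
    exact (ih.map _).mul ((hA.map _).map _)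

end UnitDeterminant

section AdicCompleteness

variable {R : Type*} [CommRing R] {c : R}

theorem smodEq_span_singleton_pow_iff {n : ℕ} {x y : R} :
    x ≡ y [SMOD (Ideal.span {c} ^ n • ⊤ : Submodule R R)] ↔ c ^ n ∣ x - y := by
  rw [SModEq.sub_mem, smul_eq_mul, Ideal.mul_top, Ideal.span_singleton_pow,
    Ideal.mem_span_singleton]

theorem pow_dvd_sub_of_forall_succ {f : ℕ → R} (hf : ∀ s, c ^ s ∣ f (s + 1) - f s) {m n : ℕ}
    (hmn : m ≤ n) : c ^ m ∣ f m - f n := by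
  induction n, hmn using Nat.le_induction with
  | base => simp
  | succ n hmn ih =>
    rw [← sub_add_sub_cancel _ (f n) _]
    exact dvd_add ih ((pow_dvd_pow c hmn).trans (dvd_sub_comm.1 (hf n)))

theorem exists_forall_pow_dvd_sub [IsPrecomplete (Ideal.span {c}) R] {f : ℕ → R}
    (hf : ∀ s, c ^ s ∣ f (s + 1) - f s) : ∃ L, ∀ s, c ^ s ∣ f s - L := by
  simp only [← smodEq_span_singleton_pow_iff]
  exact IsPrecomplete.prec inferInstance fun {m n} hmn =>
    smodEq_span_singleton_pow_iff.2 (pow_dvd_sub_of_forall_succ hf hmn)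

variable {σ : Type*}

theorem C_dvd_iff_forall_dvd_coeff {φ : MvPowerSeries σ R} :
    MvPowerSeries.C c ∣ φ ↔ ∀ d, c ∣ MvPowerSeries.coeff d φ := by
  refine ⟨fun ⟨ψ, hψ⟩ d => ⟨MvPowerSeries.coeff d ψ, by rw [hψ, MvPowerSeries.coeff_C_mul]⟩,
    fun h => ?_⟩
  obtain ⟨ψ, hψ⟩ : ∃ ψ : MvPowerSeries σ R,
      ∀ d, MvPowerSeries.coeff d φ = c * MvPowerSeries.coeff d ψ := Classical.skolem.1 h
  exact ⟨ψ, MvPowerSeries.ext fun d => by rw [hψ, MvPowerSeries.coeff_C_mul]⟩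

instance isAdicComplete_mvPowerSeries [IsAdicComplete (Ideal.span {c}) R] :
    IsAdicComplete (Ideal.span {MvPowerSeries.C (σ := σ) c}) (MvPowerSeries σ R) where
  haus' φ hφ := by
    ext d
    refine IsHausdorff.haus (I := Ideal.span {c}) inferInstance _ fun n => ?_
    have h := smodEq_span_singleton_pow_iff.1 (hφ n)
    rw [← map_pow, C_dvd_iff_forall_dvd_coeff] at h
    rw [sub_zero] at h
    exact smodEq_span_singleton_pow_iff.2 (by rw [sub_zero]; exact h d)
  prec' f hf := by
    have hcoeff : ∀ d, ∃ l, ∀ n, c ^ n ∣ MvPowerSeries.coeff d (f n) - l := fun d =>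
      exists_forall_pow_dvd_sub fun s => by
        have h := smodEq_span_singleton_pow_iff.1 (hf s.le_succ)
        rw [← map_pow, C_dvd_iff_forall_dvd_coeff] at h
        rw [dvd_sub_comm, ← map_sub]
        exact h d
    obtain ⟨L, hL⟩ : ∃ L : MvPowerSeries σ R, ∀ d n,
        c ^ n ∣ MvPowerSeries.coeff d (f n) - MvPowerSeries.coeff d L := Classical.skolem.1 hcoeff
    refine ⟨L, fun n => smodEq_span_singleton_pow_iff.2 ?_⟩
    rw [← map_pow, C_dvd_iff_forall_dvd_coeff]
    intro d
    rw [map_sub]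
    exact hL d n

theorem isLeftRegular_C (hc : IsLeftRegular c) :
    IsLeftRegular (MvPowerSeries.C (σ := σ) c) := fun φ ψ h =>
  MvPowerSeries.ext fun d => hc <| by simpa using congrArg (MvPowerSeries.coeff d) h

end AdicCompleteness

section RingOfIntegers

open scoped NormedField Valued

variable {K : Type*} [NontriviallyNormedField K] [IsUltrametricDist K]

theorem dvd_integer_iff_norm_le {x y : 𝒪[K]} : x ∣ y ↔ ‖y‖ ≤ ‖x‖ := by
  rw [← Ideal.mem_span_singleton, ← SetLike.mem_coe,
    Valued.integer.coe_span_singleton_eq_closedBall, mem_closedBall_zero_iff]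

theorem hasBasis_nhds_zero_span_pow {c : 𝒪[K]} (hc0 : c ≠ 0) (hc1 : ‖c‖ < 1) :
    (nhds (0 : 𝒪[K])).HasBasis (fun _ : ℕ => True)
      fun n => ((Ideal.span {c} ^ n : Ideal 𝒪[K]) : Set 𝒪[K]) := by
  simpa only [Ideal.span_singleton_pow, Valued.integer.coe_span_singleton_eq_closedBall,
    norm_pow] using Metric.nhds_basis_closedBall_pow (x := (0 : 𝒪[K])) (norm_pos_iff.2 hc0) hc1

instance : IsLinearTopology 𝒪[K] 𝒪[K] := by
  obtain ⟨c, hc0, hc1⟩ := Valued.integer.exists_norm_lt_one K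
  exact IsLinearTopology.mk_of_hasBasis _ (hasBasis_nhds_zero_span_pow (norm_pos_iff.1 hc0) hc1)

instance [CompleteSpace K] : CompleteSpace 𝒪[K] :=
  (Valued.isClosed_integer K).completeSpace_coe

theorem isAdicComplete_integer [CompleteSpace K] {c : 𝒪[K]} (hc0 : c ≠ 0) (hc1 : ‖c‖ < 1) :
    IsAdicComplete (Ideal.span {c}) 𝒪[K] := by
  have hbasis := hasBasis_nhds_zero_span_pow hc0 hc1
  have hadic : IsAdic (Ideal.span {c}) := isAdic_iff.2
    ⟨fun n => AddSubgroup.isOpen_of_mem_nhds (Submodule.toAddSubgroup _)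
        (hbasis.mem_of_mem trivial),
      fun s hs => by simpa using hbasis.mem_iff.1 hs⟩
  exact hadic.isAdicComplete_iff.2 ⟨inferInstance, inferInstance⟩

theorem hasEval_of_norm_lt_one {σ : Type*} [Finite σ] {x : σ → 𝒪[K]} (hx : ∀ j, ‖x j‖ < 1) :
    MvPowerSeries.HasEval x where
  hpow j := tendsto_pow_atTop_nhds_zero_of_norm_lt_one (hx j)
  tendsto_zero := by simp [Filter.cofinite_eq_bot]

/-- Evaluation of an integral power series at a point of the open unit polydisc. -/
def evalSeries [CompleteSpace K] {σ : Type*} [Finite σ] {x : σ → 𝒪[K]} (hx : ∀ j, ‖x j‖ < 1) :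
    MvPowerSeries σ 𝒪[K] →+* 𝒪[K] :=
  (MvPowerSeries.aeval (R := 𝒪[K]) (hasEval_of_norm_lt_one hx) : _ →ₐ[𝒪[K]] 𝒪[K])

theorem evalSeries_C [CompleteSpace K] {σ : Type*} [Finite σ] {x : σ → 𝒪[K]}
    (hx : ∀ j, ‖x j‖ < 1) (r : 𝒪[K]) : evalSeries hx (MvPowerSeries.C r) = r :=
  (MvPowerSeries.aeval (R := 𝒪[K]) (hasEval_of_norm_lt_one hx)).commutes r

theorem evalSeries_X [CompleteSpace K] {σ : Type*} [Finite σ] {x : σ → 𝒪[K]}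
    (hx : ∀ j, ‖x j‖ < 1) (j : σ) : evalSeries hx (MvPowerSeries.X j) = x j := by
  rw [← MvPolynomial.coe_X]
  exact (MvPowerSeries.aeval_coe (hasEval_of_norm_lt_one hx) (MvPolynomial.X j)).trans
    (MvPolynomial.aeval_X x j)

theorem degree_eq_length_toList {σ : Type*} (d : σ →₀ ℕ) :
    d.degree = d.toMultiset.toList.length := by
  rw [Multiset.length_toList, Finsupp.card_toMultiset]
  rfl

/-- The variables of a monomial, listed with multiplicity. -/
def monomialIndex {σ : Type*} (d : σ →₀ ℕ) (i : Fin d.degree) : σ :=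
  d.toMultiset.toList.get (i.cast (degree_eq_length_toList d))

theorem prod_monomialIndex {σ M : Type*} [CommMonoid M] (d : σ →₀ ℕ) (y : σ → M) :
    ∏ i, y (monomialIndex d i) = d.prod fun j k => y j ^ k :=
  calc ∏ i, y (monomialIndex d i) = ∏ i, y (d.toMultiset.toList.get i) :=
        Fintype.prod_equiv (finCongr (degree_eq_length_toList d)) _ _ fun _ => rfl
    _ = (d.toMultiset.map y).prod := by
        rw [← Multiset.prod_map_toList]
        exact Fin.prod_univ_fun_getElem _ _
    _ = d.prod fun j k => y j ^ k := by
        rw [Finsupp.toMultiset_map, Finsupp.prod_toMultiset,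
          Finsupp.prod_mapDomain_index (fun _ => pow_zero _) fun _ _ _ => pow_add _ _ _]

instance {σ : Type*} [Finite σ] (k : ℕ) : Finite {d : σ →₀ ℕ // d.degree = k} :=
  (Finsupp.finite_of_degree_eq k).to_subtype

instance {σ : Type*} [Finite σ] (k : ℕ) : Fintype {d : σ →₀ ℕ // d.degree = k} :=
  Fintype.ofFinite _

variable {σ : Type*} [Fintype σ]

/-- The homogeneous parts of an integral power series as continuous multilinear maps. They are
not symmetric: each monomial is polarized with its variables in a chosen order. -/
def homogeneousSeries (φ : MvPowerSeries σ 𝒪[K]) : FormalMultilinearSeries K (σ → K) K := fun k =>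
  ∑ d : {d : σ →₀ ℕ // d.degree = k}, ((MvPowerSeries.coeff d.1 φ : 𝒪[K]) : K) •
    (ContinuousMultilinearMap.mkPiAlgebra K (Fin k) K).compContinuousLinearMap
      fun i => ContinuousLinearMap.proj (monomialIndex d.1 (i.cast d.2.symm))

theorem homogeneousSeries_apply (φ : MvPowerSeries σ 𝒪[K]) (k : ℕ) (v : Fin k → σ → K) :
    homogeneousSeries φ k v = ∑ d : {d : σ →₀ ℕ // d.degree = k},
      ((MvPowerSeries.coeff d.1 φ : 𝒪[K]) : K) *
        ∏ i, v i (monomialIndex d.1 (i.cast d.2.symm)) := by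
  simp [homogeneousSeries, sum_apply]

theorem homogeneousSeries_apply_const (φ : MvPowerSeries σ 𝒪[K]) (k : ℕ) (y : σ → K) :
    homogeneousSeries φ k (fun _ => y) = ∑ d : {d : σ →₀ ℕ // d.degree = k},
      ((MvPowerSeries.coeff d.1 φ : 𝒪[K]) : K) * d.1.prod fun j c => y j ^ c := by
  rw [homogeneousSeries_apply]
  refine Finset.sum_congr rfl ?_
  rintro ⟨d, rfl⟩ -
  rw [← prod_monomialIndex]
  rfl

theorem norm_homogeneousSeries_le_one (φ : MvPowerSeries σ 𝒪[K]) (k : ℕ) :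
    ‖homogeneousSeries φ k‖ ≤ 1 := by
  refine ContinuousMultilinearMap.opNorm_le_bound zero_le_one fun v => ?_
  rw [homogeneousSeries_apply, one_mul]
  have hprod : 0 ≤ ∏ i, ‖v i‖ := Finset.prod_nonneg fun _ _ => norm_nonneg _
  refine IsUltrametricDist.norm_sum_le_of_forall_le_of_nonneg hprod fun d _ => ?_
  rw [norm_mul, norm_prod]
  calc _ ≤ 1 * ∏ i, ‖v i‖ := by
        gcongr with i
        · exact Valued.integer.norm_le_one _
        · exact norm_le_pi_norm (v i) _
    _ = _ := one_mul _

theorem hasSum_homogeneousSeries [CompleteSpace K] (φ : MvPowerSeries σ 𝒪[K]) {x : σ → 𝒪[K]}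
    (hx : ∀ j, ‖x j‖ < 1) :
    HasSum (fun k => homogeneousSeries φ k fun _ j => (x j : K))
      (evalSeries hx φ) := by
  have hsum := ((MvPowerSeries.hasSum_aeval (hasEval_of_norm_lt_one hx) φ).map
    (𝒪[K]).subtype.toAddMonoidHom continuous_subtype_val)
  refine ((Equiv.sigmaFiberEquiv fun d : σ →₀ ℕ => d.degree).hasSum_iff.2 hsum).sigma fun k => ?_
  rw [homogeneousSeries_apply_const]
  convert hasSum_fintype _ using 3 with d
  simp [Finsupp.prod]

theorem hasFPowerSeriesOnBall_homogeneousSeries [CompleteSpace K] (φ : MvPowerSeries σ 𝒪[K])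
    {f : (σ → K) → K} {a : σ → K}
    (hf : ∀ (x : σ → 𝒪[K]) (hx : ∀ j, ‖x j‖ < 1),
      f (a + fun j => (x j : K)) = (evalSeries hx φ)) :
    HasFPowerSeriesOnBall f (homogeneousSeries φ) a 1 where
  r_le := by
    exact_mod_cast (homogeneousSeries φ).le_radius_of_bound 1 (r := 1) fun k => by
      simpa using norm_homogeneousSeries_le_one φ k
  r_pos := one_pos
  hasSum {y} hy := by
    have hy1 : ‖y‖ < 1 := by
      simpa [Metric.mem_eball, edist_zero_right, ← ofReal_norm] using hy
    have hyj : ∀ j, ‖y j‖ < 1 := fun j => (norm_le_pi_norm y j).trans_lt hy1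
    lift y to σ → 𝒪[K] using fun j => Valued.integer.mem_iff.2 (hyj j).le
    rw [hf y hyj]
    exact hasSum_homogeneousSeries φ hyj

end RingOfIntegers

section DworkFamily

variable {R S : Type*} [CommRing R] [CommRing S] {κ : Type*} {p e P g : ℕ} {F : R[X]}
  {M : ℕ → Matrix κ (Fin g) R}

/-- Each row of `M s`, `1 ≤ s`, is an integer multiple of the coefficient vector of a fixed
polynomial, and these multiples converge `p`-adically. This is the common shape of the
Hasse--Witt matrices, of the matrices of solutions, and of their partial derivatives. -/
def IsDworkFamily (p P g : ℕ) (F : R[X]) (M : ℕ → Matrix κ (Fin g) R) : Prop :=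
  ∀ j, ∃ (E : R[X]) (α : ℕ → ℤ), IsAdmissible P g E ∧ (∀ s, (p : ℤ) ^ s ∣ α (s + 1) - α s) ∧
    ∀ s, 1 ≤ s → M s j = (α s : R) • coeffVec F P g s E

theorem IsDworkFamily.map (h : IsDworkFamily p P g F M) (φ : R →+* S) :
    IsDworkFamily p P g (F.map φ) fun s => (M s).map φ := fun j => by
  obtain ⟨E, α, hE, hα, hM⟩ := h j
  refine ⟨E.map φ, α, hE.map φ, hα, fun s hs => ?_⟩
  rw [← map_coeffVec]
  ext v
  simp [hM s hs]

theorem dvd_mul_sub_mul {d a a' b b' : R} (ha : d ∣ a' - a) (hb : d ∣ b' - b) :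
    d ∣ a' * b' - a * b := by
  rw [show a' * b' - a * b = (a' - a) * b' + a * (b' - b) by ring]
  exact dvd_add (ha.mul_right _) (hb.mul_left _)

theorem IsDworkFamily.pow_dvd_succ_sub (h : IsDworkFamily p (p ^ e) g F M) (hp : p.Prime)
    (he : 0 < e) (hreg : IsLeftRegular (p : R)) (hF : F.natDegree ≤ (g + 1) * (p ^ e - 1))
    (hA : ∀ b, 1 ≤ b → IsUnit (coeffMatrix F (p ^ e) g b).det) (s : ℕ) (j : κ) (v : Fin g) :
    (p : R) ^ s ∣ (M (s + 1) * (coeffMatrix F (p ^ e) g (s + 1))⁻¹) j v -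
      (M s * (coeffMatrix F (p ^ e) g s)⁻¹) j v := by
  rcases Nat.eq_zero_or_pos s with rfl | hs
  · simp
  obtain ⟨E, α, hE, hα, hM⟩ := h j
  have hrow : ∀ t, 1 ≤ t → (M t * (coeffMatrix F (p ^ e) g t)⁻¹) j v =
      α t * normalizedCoeffVec F (p ^ e) g t E v := fun t ht => by
    rw [Matrix.mul_apply_eq_vecMul, hM t ht, Matrix.smul_vecMul]
    rfl
  rw [hrow s hs, hrow (s + 1) s.succ_pos]
  refine dvd_mul_sub_mul ?_ (pow_dvd_normalizedCoeffVec_succ_sub hp he hreg hF hA hE s v)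
  simpa using map_dvd (Int.castRingHom R) (hα s)

theorem IsDworkFamily.exists_limit [IsAdicComplete (Ideal.span {(p : R)}) R]
    (h : IsDworkFamily p (p ^ e) g F M) (hp : p.Prime) (he : 0 < e) (hreg : IsLeftRegular (p : R))
    (hF : F.natDegree ≤ (g + 1) * (p ^ e - 1)) (hA : IsUnit (coeffMatrix F (p ^ e) g 1).det) :
    ∃ L : Matrix κ (Fin g) R, ∀ s j v,
      (p : R) ^ s ∣ (M s * (coeffMatrix F (p ^ e) g s)⁻¹) j v - L j v := by
  have hunit := fun b hb => isUnit_det_coeffMatrix hp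
    (IsAdicComplete.le_jacobson_bot (Ideal.span {(p : R)})) hF hA (s := b) hb
  choose L hL using fun j v => exists_forall_pow_dvd_sub
    (f := fun s => (M s * (coeffMatrix F (p ^ e) g s)⁻¹) j v)
    fun s => h.pow_dvd_succ_sub hp he hreg hF hunit s j v
  exact ⟨L, fun s j v => hL j v s⟩

end DworkFamily

section Specialization

theorem map_mul_nonsing_inv {R S κ ι : Type*} [CommRing R] [CommRing S] [Fintype ι]
    [DecidableEq ι] (φ : R →+* S) (M : Matrix κ ι R) {A : Matrix ι ι R} (hA : IsUnit A.det) :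
    (M * A⁻¹).map φ = M.map φ * (A.map φ)⁻¹ := by
  have hinv : A.map φ * A⁻¹.map φ = 1 := by
    rw [← Matrix.map_mul, Matrix.mul_nonsing_inv _ hA, Matrix.map_one _ φ.map_zero φ.map_one]
  rw [Matrix.map_mul, Matrix.inv_eq_right_inv hinv]

variable {σ R S : Type*} [CommRing R] [CommRing S]

/-- Evaluation at a point, as a ring homomorphism; it is used to specialize the coefficients of
polynomials in one more variable and the entries of matrices. -/
def evalAt (a : σ → R) : MvPolynomial σ ℤ →+* R :=
  (MvPolynomial.aeval a : MvPolynomial σ ℤ →ₐ[ℤ] R)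

theorem comp_evalAt (ψ : R →+* S) (a : σ → R) : ψ.comp (evalAt a) = evalAt (ψ ∘ a) :=
  MvPolynomial.ringHom_ext (fun r => by simp [evalAt]) fun j => by simp [evalAt]

theorem map_evalAt_map {κ ι : Type*} (M : Matrix κ ι (MvPolynomial σ ℤ)) (ψ : R →+* S)
    (a : σ → R) : (M.map (evalAt a)).map ψ = M.map (evalAt (ψ ∘ a)) := by
  rw [← comp_evalAt, Matrix.map_map]
  rfl

/-- The generic point of the open unit polydisc around `a`. -/
def genericPoint (a : σ → R) (j : σ) : MvPowerSeries σ R :=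
  MvPowerSeries.C (a j) + MvPowerSeries.X j

theorem constantCoeff_comp_genericPoint (a : σ → R) :
    MvPowerSeries.constantCoeff ∘ genericPoint a = a := by
  ext j
  simp [genericPoint]

theorem isUnit_det_map_evalAt_genericPoint {ι : Type*} [Fintype ι] [DecidableEq ι]
    {A : Matrix ι ι (MvPolynomial σ ℤ)} {a : σ → R} :
    IsUnit (A.map (evalAt (genericPoint a))).det ↔ IsUnit (A.map (evalAt a)).det := by
  rw [MvPowerSeries.isUnit_iff_constantCoeff, RingHom.map_det, RingHom.mapMatrix_apply,
    map_evalAt_map, constantCoeff_comp_genericPoint]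

theorem IsDworkFamily.exists_powerSeries_limit {κ : Type*} {p e g : ℕ}
    {F : (MvPolynomial σ ℤ)[X]} {M : ℕ → Matrix κ (Fin g) (MvPolynomial σ ℤ)}
    (h : IsDworkFamily p (p ^ e) g F M) (hp : p.Prime) (he : 0 < e)
    [IsAdicComplete (Ideal.span {(p : R)}) R] (hreg : IsLeftRegular (p : R))
    (hF : F.natDegree ≤ (g + 1) * (p ^ e - 1)) {a : σ → R}
    (ha : IsUnit ((coeffMatrix F (p ^ e) g 1).map (evalAt a)).det) :
    ∃ L : Matrix κ (Fin g) (MvPowerSeries σ R),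
      ∀ (ψ : MvPowerSeries σ R →+* S) (s : ℕ), 1 ≤ s → ∀ j v,
        (p : S) ^ s ∣ ((M s).map (evalAt (ψ ∘ genericPoint a)) *
          ((coeffMatrix F (p ^ e) g s).map (evalAt (ψ ∘ genericPoint a)))⁻¹) j v - ψ (L j v) := by
  have hadic : IsAdicComplete (Ideal.span {(p : MvPowerSeries σ R)}) (MvPowerSeries σ R) := by
    rw [← map_natCast MvPowerSeries.C]
    infer_instance
  have hregX : IsLeftRegular (p : MvPowerSeries σ R) := by
    rw [← map_natCast MvPowerSeries.C]
    exact isLeftRegular_C hreg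
  have hFX := (natDegree_map_le (f := evalAt (genericPoint a))).trans hF
  have haX := isUnit_det_map_evalAt_genericPoint.2 ha
  rw [map_coeffMatrix] at haX
  obtain ⟨L, hL⟩ := (h.map (evalAt (genericPoint a))).exists_limit hp he hregX hFX haX
  refine ⟨L, fun ψ s hs j v => ?_⟩
  have hunit := isUnit_det_coeffMatrix hp
    (IsAdicComplete.le_jacobson_bot (Ideal.span {(p : MvPowerSeries σ R)})) hFX haX hs
  have hdvd := map_dvd ψ (hL s j v)
  rw [map_sub, map_pow, map_natCast] at hdvd
  rwa [← map_evalAt_map, ← map_evalAt_map, map_coeffMatrix, ← map_mul_nonsing_inv ψ _ hunit]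

open scoped NormedField Valued

variable {K : Type*} [NontriviallyNormedField K] [IsUltrametricDist K] [CompleteSpace K]

theorem evalSeries_comp_genericPoint [Finite σ] (a : σ → 𝒪[K]) {x : σ → 𝒪[K]}
    (hx : ∀ j, ‖x j‖ < 1) : evalSeries hx ∘ genericPoint a = a + x := by
  ext1 j
  simp only [Function.comp_apply, genericPoint, map_add, evalSeries_C, evalSeries_X, Pi.add_apply]

end Specialization

section OrdinaryLocus

open scoped NormedField Valued

variable {n g p e : ℕ} {κ : Type} {K : Type} [NontriviallyNormedField K] [IsUltrametricDist K]

/-- The points with integral coordinates at which the determinant of `A` is a unit of the ring of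
integers of `K`. -/
def ordinaryLocus (K : Type) [NontriviallyNormedField K]
    (A : Matrix (Fin g) (Fin g) (MvPolynomial (Fin n) ℤ)) : Set (Fin n → K) :=
  {a | (∀ j, ‖a j‖ ≤ 1) ∧ ‖(matEval A a).det‖ = 1}

theorem map_evalAt_map_subtype {ι : Type} (M : Matrix κ ι (MvPolynomial (Fin n) ℤ))
    (a : Fin n → 𝒪[K]) :
    (M.map (evalAt a)).map 𝒪[K].subtype = matEval M fun j => (a j : K) :=
  map_evalAt_map M 𝒪[K].subtype a

theorem mem_ordinaryLocus_iff_isUnit {A : Matrix (Fin g) (Fin g) (MvPolynomial (Fin n) ℤ)}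
    {a : Fin n → 𝒪[K]} :
    (fun j => (a j : K)) ∈ ordinaryLocus K A ↔ IsUnit (A.map (evalAt a)).det := by
  rw [Valued.integer.isUnit_iff_norm_eq_one, ordinaryLocus, Set.mem_ofPred_eq,
    ← map_evalAt_map_subtype, ← RingHom.mapMatrix_apply, ← RingHom.map_det]
  exact and_iff_right fun _ => Valued.integer.norm_le_one _

theorem exists_integer_of_mem_ordinaryLocus {A : Matrix (Fin g) (Fin g) (MvPolynomial (Fin n) ℤ)}
    {a : Fin n → K} (ha : a ∈ ordinaryLocus K A) :
    ∃ b : Fin n → 𝒪[K], (fun j => (b j : K)) = a ∧ IsUnit (A.map (evalAt b)).det := by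
  lift a to Fin n → 𝒪[K] using fun j => Valued.integer.mem_iff.2 (ha.1 j)
  exact ⟨a, rfl, mem_ordinaryLocus_iff_isUnit.1 ha⟩

theorem isUnit_det_map_evalAt_add [CompleteSpace K]
    {A : Matrix (Fin g) (Fin g) (MvPolynomial (Fin n) ℤ)} {a x : Fin n → 𝒪[K]}
    (ha : IsUnit (A.map (evalAt a)).det) (hx : ∀ j, ‖x j‖ < 1) :
    IsUnit (A.map (evalAt (a + x))).det := by
  have h := (isUnit_det_map_evalAt_genericPoint.2 ha).map (evalSeries hx)
  rwa [RingHom.map_det, RingHom.mapMatrix_apply, map_evalAt_map, evalSeries_comp_genericPoint] at h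

variable [CompleteSpace K]

theorem isAdicComplete_integer_natCast (hp0 : (p : K) ≠ 0) (hp1 : ‖(p : K)‖ < 1) :
    IsAdicComplete (Ideal.span {(p : 𝒪[K])}) 𝒪[K] :=
  isAdicComplete_integer (fun h0 => hp0 (by simpa using congrArg Subtype.val h0))
    (by simpa using! hp1)

theorem isUnit_det_map_evalAt_coeffMatrix (hp : p.Prime) (hp0 : (p : K) ≠ 0)
    (hp1 : ‖(p : K)‖ < 1) {F : (MvPolynomial (Fin n) ℤ)[X]}
    (hF : F.natDegree ≤ (g + 1) * (p ^ e - 1)) {a : Fin n → 𝒪[K]}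
    (ha : IsUnit ((coeffMatrix F (p ^ e) g 1).map (evalAt a)).det) {s : ℕ} (hs : 1 ≤ s) :
    IsUnit ((coeffMatrix F (p ^ e) g s).map (evalAt a)).det := by
  have := isAdicComplete_integer_natCast hp0 hp1
  rw [map_coeffMatrix] at ha ⊢
  exact isUnit_det_coeffMatrix hp (IsAdicComplete.le_jacobson_bot _) (natDegree_map_le.trans hF)
    ha hs

theorem norm_det_matEval_coeffMatrix (hp : p.Prime) (hp0 : (p : K) ≠ 0)
    (hp1 : ‖(p : K)‖ < 1) {F : (MvPolynomial (Fin n) ℤ)[X]}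
    (hF : F.natDegree ≤ (g + 1) * (p ^ e - 1)) {a : Fin n → K}
    (ha : a ∈ ordinaryLocus K (coeffMatrix F (p ^ e) g 1)) {s : ℕ} (hs : 1 ≤ s) :
    ‖(matEval (coeffMatrix F (p ^ e) g s) a).det‖ = 1 := by
  obtain ⟨a, rfl, hunit⟩ := exists_integer_of_mem_ordinaryLocus ha
  exact (mem_ordinaryLocus_iff_isUnit.2
    (isUnit_det_map_evalAt_coeffMatrix hp hp0 hp1 hF hunit hs)).2

theorem IsDworkFamily.exists_norm_sub_evalSeries_le {F : (MvPolynomial (Fin n) ℤ)[X]}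
    {M : ℕ → Matrix κ (Fin g) (MvPolynomial (Fin n) ℤ)} (h : IsDworkFamily p (p ^ e) g F M)
    (hp : p.Prime) (he : 0 < e) (hp0 : (p : K) ≠ 0) (hp1 : ‖(p : K)‖ < 1)
    (hF : F.natDegree ≤ (g + 1) * (p ^ e - 1)) {a : Fin n → 𝒪[K]}
    (ha : IsUnit ((coeffMatrix F (p ^ e) g 1).map (evalAt a)).det) :
    ∃ L : Matrix κ (Fin g) (MvPowerSeries (Fin n) 𝒪[K]),
      ∀ (x : Fin n → 𝒪[K]) (hx : ∀ j, ‖x j‖ < 1) (s : ℕ), 1 ≤ s → ∀ j v,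
        ‖(matEval (M s) (fun i => ((a + x) i : K)) *
          (matEval (coeffMatrix F (p ^ e) g s) fun i => ((a + x) i : K))⁻¹) j v -
            (evalSeries hx (L j v) : 𝒪[K])‖ ≤ ‖(p : K)‖ ^ s := by
  have := isAdicComplete_integer_natCast hp0 hp1
  have hreg : IsLeftRegular (p : 𝒪[K]) :=
    IsLeftCancelMulZero.mul_left_cancel_of_ne_zero fun h0 =>
      hp0 (by simpa using congrArg Subtype.val h0)
  obtain ⟨L, hL⟩ := h.exists_powerSeries_limit (S := 𝒪[K]) hp he hreg hF ha
  refine ⟨L, fun x hx s hs j v => ?_⟩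
  have hdvd := dvd_integer_iff_norm_le.1 (hL (evalSeries hx) s hs j v)
  have hunit := isUnit_det_map_evalAt_coeffMatrix hp hp0 hp1 hF
    (isUnit_det_map_evalAt_add ha hx) hs
  rw [evalSeries_comp_genericPoint] at hdvd
  rw [← map_evalAt_map_subtype, ← map_evalAt_map_subtype, ← map_mul_nonsing_inv _ _ hunit]
  refine hdvd.trans_eq ?_
  rw [norm_pow]
  simp

theorem tendsto_of_norm_sub_le_pow {E : Type*} [SeminormedAddCommGroup E] {f : ℕ → E} {x : E}
    {r : ℝ} (hr0 : 0 ≤ r) (hr1 : r < 1) (h : ∀ s, 1 ≤ s → ‖f s - x‖ ≤ r ^ s) :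
    Filter.Tendsto f Filter.atTop (nhds x) :=
  tendsto_iff_norm_sub_tendsto_zero.2 <| squeeze_zero' (.of_forall fun _ => norm_nonneg _)
    ((Filter.eventually_ge_atTop 1).mono h) (tendsto_pow_atTop_nhds_zero_of_lt_one hr0 hr1)

theorem tendstoUniformlyOn_of_norm_sub_le_pow {α E : Type*} [SeminormedAddCommGroup E]
    {f : ℕ → α → E} {G : α → E} {D : Set α} {r : ℝ} (hr0 : 0 ≤ r) (hr1 : r < 1)
    (h : ∀ s, 1 ≤ s → ∀ a ∈ D, ‖f s a - G a‖ ≤ r ^ s) :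
    TendstoUniformlyOn f G Filter.atTop D := by
  rw [Metric.tendstoUniformlyOn_iff]
  intro ε hε
  filter_upwards [(tendsto_pow_atTop_nhds_zero_of_lt_one hr0 hr1).eventually (gt_mem_nhds hε),
    Filter.eventually_ge_atTop 1] with s hs hs1 a ha
  rw [dist_comm, dist_eq_norm]
  exact (h s hs1 a ha).trans_lt hs

theorem tendstoUniformlyOn_matrix {α β ι E : Type*} [UniformSpace E]
    {f : ℕ → α → Matrix β ι E} {G : α → Matrix β ι E} {D : Set α}
    (h : ∀ k l, TendstoUniformlyOn (fun s a => f s a k l) (fun a => G a k l) Filter.atTop D) :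
    TendstoUniformlyOn f G Filter.atTop D := by
  simp only [tendstoUniformlyOn_iff_tendsto] at h ⊢
  simp only [Matrix.uniformity, Filter.tendsto_iInf, Filter.tendsto_comap_iff]
  exact h

theorem IsDworkFamily.exists_analytic_limit {F : (MvPolynomial (Fin n) ℤ)[X]}
    {M : ℕ → Matrix κ (Fin g) (MvPolynomial (Fin n) ℤ)} (h : IsDworkFamily p (p ^ e) g F M)
    (hp : p.Prime) (he : 0 < e) (hp0 : (p : K) ≠ 0) (hp1 : ‖(p : K)‖ < 1)
    (hF : F.natDegree ≤ (g + 1) * (p ^ e - 1))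
    {A : ℕ → Matrix (Fin g) (Fin g) (MvPolynomial (Fin n) ℤ)}
    (hA : ∀ s, 1 ≤ s → A s = coeffMatrix F (p ^ e) g s) :
    ∃ G : (Fin n → K) → Matrix κ (Fin g) K,
      TendstoUniformlyOn
        (fun s a => matEval (M s) a * (matEval (A s) a)⁻¹) G
        Filter.atTop (ordinaryLocus K (A 1)) ∧
      AnalyticOnUnitPolydiscs (ordinaryLocus K (A 1)) G := by
  rw [hA 1 le_rfl]
  have hlim : ∀ y ∈ ordinaryLocus K (coeffMatrix F (p ^ e) g 1), ∃ G : Matrix κ (Fin g) K,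
      ∀ j v s, 1 ≤ s → ‖(matEval (M s) y * (matEval (A s) y)⁻¹) j v - G j v‖ ≤
        ‖(p : K)‖ ^ s := fun y hy => by
    obtain ⟨b, rfl, hb⟩ := exists_integer_of_mem_ordinaryLocus hy
    obtain ⟨L, hL⟩ := h.exists_norm_sub_evalSeries_le hp he hp0 hp1 hF hb
    have h0 := hL 0 (by simp)
    rw [add_zero] at h0
    exact ⟨_, fun j v s hs => by rw [hA s hs]; exact h0 s hs j v⟩
  choose! G hG using hlim
  refine ⟨G, tendstoUniformlyOn_matrix fun j v => tendstoUniformlyOn_of_norm_sub_le_pow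
    (norm_nonneg _) hp1 fun s hs a ha => hG a ha j v s hs, fun a ha j v => ?_⟩
  obtain ⟨b, rfl, hb⟩ := exists_integer_of_mem_ordinaryLocus ha
  obtain ⟨L, hL⟩ := h.exists_norm_sub_evalSeries_le hp he hp0 hp1 hF hb
  refine ⟨homogeneousSeries (L j v), hasFPowerSeriesOnBall_homogeneousSeries _ fun x hx => ?_⟩
  have hbx := mem_ordinaryLocus_iff_isUnit.2 (isUnit_det_map_evalAt_add hb hx)
  exact tendsto_nhds_unique
    (tendsto_of_norm_sub_le_pow (norm_nonneg _) hp1 (hG _ hbx j v))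
    (tendsto_of_norm_sub_le_pow (norm_nonneg _) hp1 fun s hs => by
      rw [hA s hs]
      exact hL x hx s hs j v)

end OrdinaryLocus

section Taylor

theorem exists_evalAt_add_single {σ R : Type*} [DecidableEq σ] [CommRing R] (a : σ → R) (i : σ)
    (t : R) (f : MvPolynomial σ ℤ) :
    ∃ r, evalAt (a + Pi.single i t) f =
      evalAt a f + t * evalAt a (MvPolynomial.pderiv i f) + t ^ 2 * r := by
  induction f using MvPolynomial.induction_on with
  | C c => exact ⟨0, by simp [evalAt]⟩
  | add f h hf hh =>
    obtain ⟨r, hr⟩ := hf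
    obtain ⟨r', hr'⟩ := hh
    exact ⟨r + r', by simp only [map_add, hr, hr']; ring⟩
  | mul_X f j hf =>
    obtain ⟨r, hr⟩ := hf
    have hX : ∀ b : σ → R, evalAt b (MvPolynomial.X j) = b j := fun b => by simp [evalAt]
    set d := evalAt a (MvPolynomial.pderiv i (MvPolynomial.X j)) with hd
    have hdt : (Pi.single i t : σ → R) j = d * t := by
      rcases eq_or_ne j i with rfl | hj
      · simp [hd]
      · simp [hd, hj, MvPolynomial.pderiv_X_of_ne hj]
    refine ⟨evalAt a (MvPolynomial.pderiv i f) * d + r * (a j + d * t), ?_⟩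
    simp only [map_mul, map_add, Derivation.leibniz, hr, hX, Pi.add_apply, smul_eq_mul, hdt, ← hd]
    ring

theorem exists_map_evalAt_add_single {n : ℕ} {R : Type*} [CommRing R] {ι κ : Type}
    (a : Fin n → R) (i : Fin n) (t : R) (M : Matrix ι κ (MvPolynomial (Fin n) ℤ)) :
    ∃ W : Matrix ι κ R, M.map (evalAt (a + Pi.single i t)) =
      M.map (evalAt a) + t • (matPDeriv i M).map (evalAt a) + t ^ 2 • W := by
  choose r hr using fun k l => exists_evalAt_add_single a i t (M k l)
  exact ⟨Matrix.of r, by ext k l; simpa [matPDeriv] using hr k l⟩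

theorem exists_mul_inv_eq_add_smul_add_sq_smul {R ι κ : Type*} [CommRing R] [Fintype ι]
    [DecidableEq ι] {t : R} {I I₁ dI U : Matrix κ ι R} {A A₁ dA V : Matrix ι ι R}
    (hA : IsUnit A.det) (hA₁ : IsUnit A₁.det) (hI_add : I₁ = I + t • dI + t ^ 2 • U)
    (hA_add : A₁ = A + t • dA + t ^ 2 • V) :
    ∃ W, I₁ * A₁⁻¹ =
      I * A⁻¹ + t • (dI * A⁻¹ - I * A⁻¹ * (dA * A⁻¹)) + t ^ 2 • W := by
  set y := I * A⁻¹
  set d := dI * A⁻¹ - y * (dA * A⁻¹) with hd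
  have hyA : y * A = I := Matrix.nonsing_inv_mul_cancel_right _ _ hA
  have hdA : d * A = dI - y * dA := by
    rw [hd, Matrix.sub_mul, Matrix.mul_assoc y, Matrix.nonsing_inv_mul_cancel_right _ _ hA,
      Matrix.nonsing_inv_mul_cancel_right _ _ hA]
  have hmul : I₁ = (y + t • d) * A₁ + t ^ 2 • (U - y * V - d * dA - t • (d * V)) := by
    rw [hI_add, hA_add]
    simp only [Matrix.add_mul, Matrix.mul_add, Matrix.smul_mul, Matrix.mul_smul, hyA, hdA]
    module
  refine ⟨(U - y * V - d * dA - t • (d * V)) * A₁⁻¹, ?_⟩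
  nth_rw 1 [hmul]
  rw [Matrix.add_mul, Matrix.mul_nonsing_inv_cancel_right _ _ hA₁, Matrix.smul_mul]

theorem hasDerivAt_of_norm_sub_le_sq {K : Type*} [NontriviallyNormedField K] {f : K → K} {x d : K}
    (h : ∀ t, ‖t‖ < 1 → ‖f (x + t) - f x - t * d‖ ≤ ‖t‖ ^ 2) : HasDerivAt f d x := by
  rw [hasDerivAt_iff_isLittleO_nhds_zero]
  refine Asymptotics.IsBigO.trans_isLittleO (g := fun t : K => t ^ 2) (.of_bound 1 ?_)
    (Asymptotics.isLittleO_pow_id one_lt_two)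
  filter_upwards [Metric.ball_mem_nhds (0 : K) one_pos] with t ht
  simpa using h t (by simpa using ht)

open scoped NormedField Valued

variable {n g : ℕ} {κ : Type} {K : Type} [NontriviallyNormedField K] [IsUltrametricDist K]
  {A : Matrix (Fin g) (Fin g) (MvPolynomial (Fin n) ℤ)}

theorem norm_matEval_mul_inv_add_single_sub_le (M : Matrix κ (Fin g) (MvPolynomial (Fin n) ℤ))
    {a b : Fin n → 𝒪[K]} {i : Fin n} {t : 𝒪[K]} (hb : b = a + Pi.single i t)
    (hA : IsUnit (A.map (evalAt a)).det) (hA' : IsUnit (A.map (evalAt b)).det)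
    (k : κ) (l : Fin g) :
    ‖(matEval M (fun j => (b j : K)) * (matEval A fun j => (b j : K))⁻¹) k l -
      (matEval M (fun j => (a j : K)) * (matEval A fun j => (a j : K))⁻¹) k l -
      t * (matEval (matPDeriv i M) (fun j => (a j : K)) * (matEval A fun j => (a j : K))⁻¹ -
        matEval M (fun j => (a j : K)) * (matEval A fun j => (a j : K))⁻¹ *
          (matEval (matPDeriv i A) (fun j => (a j : K)) *
            (matEval A fun j => (a j : K))⁻¹)) k l‖ ≤ ‖t‖ ^ 2 := by
  subst hb
  obtain ⟨U, hU⟩ := exists_map_evalAt_add_single a i t M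
  obtain ⟨V, hV⟩ := exists_map_evalAt_add_single a i t A
  obtain ⟨W, hW⟩ := exists_mul_inv_eq_add_smul_add_sq_smul hA hA' hU hV
  have hWkl := congrArg (fun N : Matrix κ (Fin g) 𝒪[K] => 𝒪[K].subtype (N k l)) hW
  simp only [← map_evalAt_map_subtype, ← map_mul_nonsing_inv _ _ hA, ← map_mul_nonsing_inv _ _ hA',
    ← Matrix.map_mul, ← Matrix.map_sub _ (map_sub 𝒪[K].subtype), Matrix.map_apply]
  rw [hWkl, Matrix.add_apply, Matrix.add_apply, Matrix.smul_apply, Matrix.smul_apply, smul_eq_mul,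
    smul_eq_mul, map_add, map_add, map_mul, map_mul, map_pow, Subring.subtype_apply t,
    add_sub_right_comm, add_sub_cancel_left, add_sub_cancel_left, norm_mul, norm_pow]
  exact mul_le_of_le_one_right (by positivity) (Valued.integer.norm_le_one _)

variable [CompleteSpace K]

theorem hasDerivAt_update_of_tendstoUniformlyOn
    {M : ℕ → Matrix κ (Fin g) (MvPolynomial (Fin n) ℤ)}
    {A : ℕ → Matrix (Fin g) (Fin g) (MvPolynomial (Fin n) ℤ)}
    (hA : ∀ s, 1 ≤ s → ordinaryLocus K (A 1) ⊆ ordinaryLocus K (A s)) {i : Fin n}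
    {J J' : (Fin n → K) → Matrix κ (Fin g) K} {A' : (Fin n → K) → Matrix (Fin g) (Fin g) K}
    (hJ : TendstoUniformlyOn (fun s a => matEval (M s) a * (matEval (A s) a)⁻¹) J
      Filter.atTop (ordinaryLocus K (A 1)))
    (hJ' : TendstoUniformlyOn (fun s a => matEval (matPDeriv i (M s)) a * (matEval (A s) a)⁻¹) J'
      Filter.atTop (ordinaryLocus K (A 1)))
    (hA' : TendstoUniformlyOn (fun s a => matEval (matPDeriv i (A s)) a * (matEval (A s) a)⁻¹) A'
      Filter.atTop (ordinaryLocus K (A 1)))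
    {a : Fin n → K} (ha : a ∈ ordinaryLocus K (A 1)) (k : κ) (l : Fin g) :
    HasDerivAt (fun t => J (Function.update a i t) k l) ((J' a - J a * A' a) k l) (a i) := by
  refine hasDerivAt_of_norm_sub_le_sq fun t ht => ?_
  rw [Function.update_eq_self]
  obtain ⟨a, rfl, hunit⟩ := exists_integer_of_mem_ordinaryLocus ha
  lift t to 𝒪[K] using Valued.integer.mem_iff.2 ht.le
  set b := a + Pi.single i t with hb
  have hunit' : IsUnit ((A 1).map (evalAt b)).det := isUnit_det_map_evalAt_add hunit fun j => by
    rcases eq_or_ne j i with rfl | hj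
    · simpa using ht
    · simp [hj]
  have hupdate : Function.update (fun j => (a j : K)) i ((a i : K) + t) = fun j => (b j : K) := by
    ext j
    rcases eq_or_ne j i with rfl | hj
    · simp [hb]
    · simp [hb, hj]
  rw [hupdate]
  have hb' := mem_ordinaryLocus_iff_isUnit.2 hunit'
  have hentry : ∀ {f : ℕ → Matrix κ (Fin g) K} {L : Matrix κ (Fin g) K},
      Filter.Tendsto f Filter.atTop (nhds L) →
      Filter.Tendsto (fun s => f s k l) Filter.atTop (nhds (L k l)) := fun h =>
    ((continuous_apply_apply k l).tendsto _).comp h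
  have hmul := ((continuous_fst.matrix_mul continuous_snd).tendsto _).comp
    ((hJ.tendsto_at ha).prodMk_nhds (hA'.tendsto_at ha))
  have hderiv := hentry ((hJ'.tendsto_at ha).sub hmul)
  refine le_of_tendsto (((hentry (hJ.tendsto_at hb')).sub (hentry (hJ.tendsto_at ha))).sub
    (hderiv.const_mul (t : K))).norm ?_
  filter_upwards [Filter.eventually_ge_atTop 1] with s hs
  exact norm_matEval_mul_inv_add_single_sub_le (M s) hb
    (mem_ordinaryLocus_iff_isUnit.1 (hA s hs ha)) (mem_ordinaryLocus_iff_isUnit.1 (hA s hs hb')) k l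

end Taylor

section MasterPolynomial

open Lagrange (nodal nodal_eq_mul_nodal_erase natDegree_nodal)
open Finset (univ)

theorem pow_sub_one_div_eq {P q s : ℕ} (hP : 0 < P) (hq : q ∣ P - 1) (hs : 1 ≤ s) :
    (P ^ s - 1) / q = (P - 1) / q * (1 + geomTail P s) := by
  have hsum : (P - 1) * (1 + geomTail P s) = P ^ s - 1 := by
    rw [← geom_sum_mul_of_one_le hP, Finset.range_eq_Ico,
      Finset.sum_eq_sum_Ico_succ_bot (Nat.lt_of_lt_of_le one_pos hs), pow_zero, mul_comm]
    rfl
  rw [← hsum, Nat.mul_div_right_comm hq]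

theorem pow_dvd_pow_sub_one_div_succ_sub {p e q : ℕ} (hp : 0 < p) (he : 0 < e)
    (hq : q ∣ p ^ e - 1) (s : ℕ) :
    (p : ℤ) ^ s ∣ (((p ^ e) ^ (s + 1) - 1) / q : ℕ) - (((p ^ e) ^ s - 1) / q : ℕ) := by
  rcases Nat.eq_zero_or_pos s with rfl | hs
  · simp
  have hP := pow_pos hp e
  rw [pow_sub_one_div_eq hP hq s.succ_pos, pow_sub_one_div_eq hP hq hs, geomTail_succ _ hs]
  have hdvd : (p : ℤ) ^ s ∣ ((p : ℤ) ^ e) ^ s := pow_dvd_pow_of_dvd (dvd_pow_self _ he.ne') s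
  refine hdvd.trans ⟨((p ^ e - 1) / q : ℕ), ?_⟩
  push_cast
  ring

theorem coeff_mul_pow_eq_coeffVec {R : Type*} [CommRing R] (H Q : R[X]) {P q g s c u : ℕ}
    (hq : q ∣ P - 1) (hg : g ≤ P) (hs : 1 ≤ s) (hc : c ≤ (P - 1) / q) (hu : u < g) (v : Fin g) :
    (H * Q ^ ((P ^ s - 1) / q - c)).coeff (P ^ s * ((v : ℕ) + 1) - (u + 1)) =
      coeffVec (Q ^ ((P - 1) / q)) P g s (X ^ (u + 1) * (H * Q ^ ((P - 1) / q - c))) v := by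
  have hle : u + 1 ≤ P ^ s * ((v : ℕ) + 1) :=
    calc u + 1 ≤ P := by omega
      _ ≤ P ^ s := Nat.le_self_pow (by omega) _
      _ ≤ _ := Nat.le_mul_of_pos_right _ (by omega)
  rw [coeffVec, mul_assoc, mul_assoc, ← pow_mul, ← pow_add, ← Nat.sub_add_comm hc,
    ← mul_one_add, ← pow_sub_one_div_eq (by omega) hq hs]
  conv_rhs => rw [← Nat.sub_add_cancel hle]
  rw [coeff_X_pow_mul]

variable {R : Type*} [CommRing R]

/-- The derivation of `R[X]` that acts by `d` on the coefficients and kills `X`. -/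
def coeffDeriv (d : Derivation ℤ R R) : Derivation ℤ R[X] R[X] :=
  PolynomialModule.equivPolynomialSelf.compDer d.mapCoeffs

theorem coeff_coeffDeriv (d : Derivation ℤ R R) (f : R[X]) (k : ℕ) :
    (coeffDeriv d f).coeff k = d (f.coeff k) :=
  rfl

theorem coeffDeriv_X_sub_C (d : Derivation ℤ R R) (r : R) :
    coeffDeriv d (X - C r) = -C (d r) := by
  ext k
  rw [coeff_coeffDeriv, coeff_sub, map_sub, coeff_X, coeff_C, coeff_neg, coeff_C]
  split_ifs <;> simp

theorem natDegree_mul_nodal_pow_le [Nontrivial R] {ι : Type*} [Fintype ι] (x : ι → R)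
    {P q g c : ℕ} {H : R[X]} (hq : q ∣ P - 1) (hι : Fintype.card ι ≤ (g + 1) * q)
    (hc : c ≤ (P - 1) / q) (hH : H.natDegree ≤ Fintype.card ι * c) :
    (H * nodal univ x ^ ((P - 1) / q - c)).natDegree ≤ (g + 1) * (P - 1) :=
  calc (H * nodal univ x ^ ((P - 1) / q - c)).natDegree
      ≤ H.natDegree + ((P - 1) / q - c) * Fintype.card ι := by
        refine natDegree_mul_le.trans (Nat.add_le_add_left (natDegree_pow_le.trans_eq ?_) _)
        rw [natDegree_nodal, Finset.card_univ]
    _ ≤ Fintype.card ι * c + ((P - 1) / q - c) * Fintype.card ι := Nat.add_le_add_right hH _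
    _ = Fintype.card ι * ((P - 1) / q) := by
        rw [mul_comm _ (Fintype.card ι), ← Nat.mul_add, Nat.add_sub_cancel' hc]
    _ ≤ (g + 1) * q * ((P - 1) / q) := Nat.mul_le_mul_right _ hι
    _ = (g + 1) * (P - 1) := by rw [mul_assoc, Nat.mul_div_cancel' hq]

section Nodal

variable {ι : Type*} [Fintype ι] [DecidableEq ι] {d : Derivation ℤ R R} {x : ι → R} {i : ι}

theorem coeffDeriv_nodal_erase (hd : d ∘ x = Pi.single i 1) :
    coeffDeriv d (nodal (univ.erase i) x) = 0 :=
  Finset.prod_induction _ (fun f => coeffDeriv d f = 0)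
    (fun f h hf hh => by rw [Derivation.leibniz, hf, hh, smul_zero, smul_zero, add_zero])
    (Derivation.map_one_eq_zero _) fun j hj => by
      have hdj : d (x j) = 0 :=
        (congrFun hd j).trans (Pi.single_eq_of_ne (Finset.ne_of_mem_erase hj) _)
      rw [coeffDeriv_X_sub_C, hdj, C_0, neg_zero]

theorem coeffDeriv_nodal_univ_pow (hd : d ∘ x = Pi.single i 1) (M : ℕ) :
    coeffDeriv d (nodal univ x ^ M) =
      ((-(M : ℤ) : ℤ) : R[X]) * (nodal (univ.erase i) x * nodal univ x ^ (M - 1)) := by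
  have hdi : d (x i) = 1 := (congrFun hd i).trans (Pi.single_eq_same _ _)
  have hbase : coeffDeriv d (nodal univ x) = -nodal (univ.erase i) x := by
    rw [nodal_eq_mul_nodal_erase (Finset.mem_univ i), Derivation.leibniz,
      coeffDeriv_nodal_erase hd, coeffDeriv_X_sub_C, hdi]
    simp
  rw [Derivation.leibniz_pow, hbase, nsmul_eq_mul, smul_eq_mul]
  push_cast
  ring

theorem coeffDeriv_nodal_erase_mul_pow (hd : d ∘ x = Pi.single i 1) (j : ι) {M : ℕ}
    (hM : 2 ≤ M) :
    coeffDeriv d (nodal (univ.erase j) x * nodal univ x ^ (M - 1)) =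
      ((-(M : ℤ) + if i = j then 1 else 0 : ℤ) : R[X]) *
        (nodal (univ.erase i) x * nodal (univ.erase j) x * nodal univ x ^ (M - 2)) := by
  obtain ⟨m, rfl⟩ := Nat.exists_eq_add_of_le' hM
  have hfactor : nodal univ x = (X - C (x j)) * nodal (univ.erase j) x :=
    nodal_eq_mul_nodal_erase (Finset.mem_univ j)
  have hdj : d (x j) = _ := congrFun hd j
  have hpow := coeffDeriv_nodal_univ_pow hd (m + 2)
  rw [show nodal univ x ^ (m + 2) =
      (X - C (x j)) * (nodal (univ.erase j) x * nodal univ x ^ (m + 1)) by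
    rw [← mul_assoc, ← hfactor, ← pow_succ'], Derivation.leibniz, coeffDeriv_X_sub_C, hdj,
    smul_eq_mul, smul_eq_mul] at hpow
  refine (monic_X_sub_C (x j)).isRegular.left (?_ : _ * _ = _ * _)
  rw [show m + 2 - 1 = m + 1 from rfl, eq_sub_of_add_eq hpow, Nat.add_sub_cancel,
    show m + 2 - 1 = m + 1 from rfl, pow_succ]
  rcases eq_or_ne i j with rfl | hij
  · rw [Pi.single_eq_same, C_1, if_pos rfl, hfactor]
    push_cast
    ring
  · rw [Pi.single_eq_of_ne' hij, C_0, if_neg hij, hfactor]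
    push_cast
    ring

theorem nodal_univ_pow_divByMonic (x : ι → R) (i : ι) {M : ℕ} (hM : 0 < M) :
    nodal univ x ^ M /ₘ (X - C (x i)) = nodal (univ.erase i) x * nodal univ x ^ (M - 1) := by
  obtain ⟨m, rfl⟩ := Nat.exists_eq_succ_of_ne_zero hM.ne'
  rw [pow_succ', nodal_eq_mul_nodal_erase (Finset.mem_univ i), mul_assoc,
    mul_divByMonic_cancel_left _ (monic_X_sub_C _), ← nodal_eq_mul_nodal_erase (Finset.mem_univ i)]
  rfl

end Nodal

variable {n p q e g : ℕ}

theorem masterPoly_eq_nodal_pow (s : ℕ) :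
    masterPoly n p q e s = nodal univ MvPolynomial.X ^ (((p ^ e) ^ s - 1) / q) := by
  rw [masterPoly, pow_mul]
  rfl

theorem masterPoly_one_eq_nodal_pow :
    masterPoly n p q e 1 = nodal univ MvPolynomial.X ^ ((p ^ e - 1) / q) := by
  rw [masterPoly_eq_nodal_pow, pow_one]

theorem natDegree_masterPoly_one_le (hqP : q ∣ p ^ e - 1) (hn : n ≤ (g + 1) * q) :
    (masterPoly n p q e 1).natDegree ≤ (g + 1) * (p ^ e - 1) := by
  simpa [masterPoly_one_eq_nodal_pow] using natDegree_mul_nodal_pow_le (H := 1) (c := 0)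
    (MvPolynomial.X (R := ℤ) (σ := Fin n)) hqP (by simpa using hn) (Nat.zero_le _) (by simp)

theorem hasseWitt_eq_coeffMatrix (hqP : q ∣ p ^ e - 1) (hgP : g ≤ p ^ e) {s : ℕ} (hs : 1 ≤ s) :
    hasseWitt n g p q e s = coeffMatrix (masterPoly n p q e 1) (p ^ e) g s := by
  ext1 u v
  have h := coeff_mul_pow_eq_coeffVec 1 (nodal univ (MvPolynomial.X (R := ℤ) (σ := Fin n))) hqP
    hgP hs (Nat.zero_le _) u.2 v
  rw [one_mul, one_mul, Nat.sub_zero, Nat.sub_zero, ← masterPoly_eq_nodal_pow,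
    ← masterPoly_one_eq_nodal_pow] at h
  rw [hasseWitt, Matrix.of_apply, pow_mul, h]
  rfl

theorem solMatrix_apply {s : ℕ} (hs : 0 < ((p ^ e) ^ s - 1) / q) (j : Fin n) (v : Fin g) :
    solMatrix n g p q e s j v =
      (nodal (univ.erase j) MvPolynomial.X *
        nodal univ MvPolynomial.X ^ (((p ^ e) ^ s - 1) / q - 1)).coeff
          ((p ^ e) ^ s * ((v : ℕ) + 1) - 1) := by
  rw [solMatrix, Matrix.of_apply, masterPoly_eq_nodal_pow, nodal_univ_pow_divByMonic _ _ hs,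
    pow_mul, mul_comm ((v : ℕ) + 1)]

theorem pderiv_comp_X (i : Fin n) :
    MvPolynomial.pderiv (R := ℤ) i ∘ MvPolynomial.X = Pi.single i 1 :=
  funext fun _ => MvPolynomial.pderiv_X i _

theorem matPDeriv_hasseWitt_apply (s : ℕ) (i : Fin n) (u v : Fin g) :
    matPDeriv i (hasseWitt n g p q e s) u v =
      ((-(((p ^ e) ^ s - 1) / q : ℕ) : ℤ) : MvPolynomial (Fin n) ℤ) *
        (nodal (univ.erase i) MvPolynomial.X *
          nodal univ MvPolynomial.X ^ (((p ^ e) ^ s - 1) / q - 1)).coeff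
            ((p ^ e) ^ s * ((v : ℕ) + 1) - ((u : ℕ) + 1)) := by
  rw [matPDeriv, Matrix.map_apply, hasseWitt, Matrix.of_apply, masterPoly_eq_nodal_pow]
  refine (coeff_coeffDeriv (MvPolynomial.pderiv i) _ _).symm.trans ?_
  rw [coeffDeriv_nodal_univ_pow (pderiv_comp_X i), coeff_intCast_mul, pow_mul]

theorem matPDeriv_solMatrix_apply {s : ℕ} (hs : 2 ≤ ((p ^ e) ^ s - 1) / q) (i j : Fin n)
    (v : Fin g) :
    matPDeriv i (solMatrix n g p q e s) j v =
      ((-(((p ^ e) ^ s - 1) / q : ℕ) + if i = j then 1 else 0 : ℤ) : MvPolynomial (Fin n) ℤ) *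
        (nodal (univ.erase i) MvPolynomial.X * nodal (univ.erase j) MvPolynomial.X *
          nodal univ MvPolynomial.X ^ (((p ^ e) ^ s - 1) / q - 2)).coeff
            ((p ^ e) ^ s * ((v : ℕ) + 1) - 1) := by
  rw [matPDeriv, Matrix.map_apply, solMatrix_apply (by omega)]
  refine (coeff_coeffDeriv (MvPolynomial.pderiv i) _ _).symm.trans ?_
  rw [coeffDeriv_nodal_erase_mul_pow (pderiv_comp_X i) j hs, coeff_intCast_mul]

theorem isDworkFamily_of_coeff (hp : 0 < p) (hqP : q ∣ p ^ e - 1) (hgP : g ≤ p ^ e)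
    (hn : n ≤ (g + 1) * q) {κ : Type*} {M : ℕ → Matrix κ (Fin g) (MvPolynomial (Fin n) ℤ)} {c : ℕ}
    (hc : c ≤ (p ^ e - 1) / q) (u : κ → Fin g) (α : κ → ℕ → ℤ)
    (hα : ∀ j s, (p : ℤ) ^ s ∣ α j (s + 1) - α j s) (H : κ → (MvPolynomial (Fin n) ℤ)[X])
    (hH : ∀ j, (H j).natDegree ≤ n * c)
    (hM : ∀ s, 1 ≤ s → ∀ j v, M s j v =
      (α j s : MvPolynomial (Fin n) ℤ) * (H j *
        nodal univ MvPolynomial.X ^ (((p ^ e) ^ s - 1) / q - c)).coeff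
          ((p ^ e) ^ s * ((v : ℕ) + 1) - ((u j : ℕ) + 1))) :
    IsDworkFamily p (p ^ e) g (masterPoly n p q e 1) M := fun j => by
  refine ⟨_, α j, isAdmissible_X_pow_mul (pow_pos hp e) (u j).2 (natDegree_mul_nodal_pow_le
    MvPolynomial.X hqP (by simpa using hn) hc (by simpa using hH j)), hα j, fun s hs => ?_⟩
  ext1 v
  rw [hM s hs, coeff_mul_pow_eq_coeffVec (H j) (nodal univ MvPolynomial.X) hqP hgP hs hc (u j).2 v,
    masterPoly_one_eq_nodal_pow]
  rfl

theorem natDegree_nodal_erase_le {R : Type*} [CommRing R] [Nontrivial R] (x : Fin n → R)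
    (j : Fin n) : (nodal (univ.erase j) x).natDegree ≤ n := by
  simp

theorem pow_dvd_neg_pow_sub_one_div_add_succ_sub (hp : 0 < p) (he : 0 < e) (hqP : q ∣ p ^ e - 1)
    (c : ℤ) (s : ℕ) :
    (p : ℤ) ^ s ∣ (-(((p ^ e) ^ (s + 1) - 1) / q : ℕ) + c) -
      (-(((p ^ e) ^ s - 1) / q : ℕ) + c) := by
  have h := pow_dvd_pow_sub_one_div_succ_sub hp he hqP s
  rwa [add_sub_add_right_eq_sub, neg_sub_neg, ← neg_sub, dvd_neg]

theorem pow_sub_one_div_le {s : ℕ} (hs : 1 ≤ s) :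
    (p ^ e - 1) / q ≤ ((p ^ e) ^ s - 1) / q :=
  Nat.div_le_div_right (Nat.sub_le_sub_right (Nat.le_self_pow (by omega) _) 1)

theorem isDworkFamily_matPDeriv_hasseWitt (hp : 0 < p) (he : 0 < e) (hqP : q ∣ p ^ e - 1)
    (hgP : g ≤ p ^ e) (hn : n ≤ (g + 1) * q) (hc : 1 ≤ (p ^ e - 1) / q) (i : Fin n) :
    IsDworkFamily p (p ^ e) g (masterPoly n p q e 1)
      fun s => matPDeriv i (hasseWitt n g p q e s) :=
  isDworkFamily_of_coeff hp hqP hgP hn hc id _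
    (fun _ s => by simpa using pow_dvd_neg_pow_sub_one_div_add_succ_sub hp he hqP 0 s) _
    (fun _ => (natDegree_nodal_erase_le _ _).trans_eq (mul_one n).symm)
    fun s _ => matPDeriv_hasseWitt_apply s i

theorem isDworkFamily_solMatrix (hp : 0 < p) (hqP : q ∣ p ^ e - 1) (hg : 0 < g)
    (hgP : g ≤ p ^ e) (hn : n ≤ (g + 1) * q) (hc : 1 ≤ (p ^ e - 1) / q) :
    IsDworkFamily p (p ^ e) g (masterPoly n p q e 1) (solMatrix n g p q e) :=
  isDworkFamily_of_coeff hp hqP hgP hn hc (fun _ => ⟨0, hg⟩) (fun _ _ => 1) (by simp) _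
    (fun j => (natDegree_nodal_erase_le MvPolynomial.X j).trans_eq (mul_one n).symm)
    fun s hs j v => by
      rw [Int.cast_one, one_mul]
      exact solMatrix_apply (hc.trans (pow_sub_one_div_le hs)) j v

theorem isDworkFamily_matPDeriv_solMatrix (hp : 0 < p) (he : 0 < e) (hqP : q ∣ p ^ e - 1)
    (hg : 0 < g) (hgP : g ≤ p ^ e) (hn : n ≤ (g + 1) * q) (hc : 2 ≤ (p ^ e - 1) / q) (i : Fin n) :
    IsDworkFamily p (p ^ e) g (masterPoly n p q e 1)
      fun s => matPDeriv i (solMatrix n g p q e s) :=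
  isDworkFamily_of_coeff hp hqP hgP hn hc (fun _ => ⟨0, hg⟩) _
    (fun _ => pow_dvd_neg_pow_sub_one_div_add_succ_sub hp he hqP _) _
    (fun j => natDegree_mul_le.trans <| (add_le_add (natDegree_nodal_erase_le _ i)
      (natDegree_nodal_erase_le _ j)).trans_eq (mul_two n).symm)
    fun _ hs => matPDeriv_solMatrix_apply (hc.trans (pow_sub_one_div_le hs)) i

end MasterPolynomial

section Unramified

variable (p m : ℕ) [Fact p.Prime]

theorem completeSpace_unramifiedExt (h : 1 < p ^ m) : CompleteSpace (unramifiedExt p m) := by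
  have : Finite {ζ : PadicAlgCl p | IsPrimitiveRoot ζ (p ^ m - 1)} :=
    (nthRootsFinset (p ^ m - 1) (1 : PadicAlgCl p)).finite_toSet.subset fun ζ hζ =>
      (mem_nthRootsFinset (Nat.sub_pos_of_lt h) _).2 hζ.pow_eq_one
  have : FiniteDimensional ℚ_[p] (unramifiedExt p m) :=
    IntermediateField.finiteDimensional_adjoin fun x _ =>
      (Algebra.IsAlgebraic.isAlgebraic x).isIntegral
  exact FiniteDimensional.complete ℚ_[p] (unramifiedExt p m)

theorem norm_natCast_unramifiedExt_lt_one : ‖(p : unramifiedExt p m)‖ < 1 := by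
  rw [← map_natCast (algebraMap ℚ_[p] (unramifiedExt p m)), norm_algebraMap']
  exact Padic.norm_p_lt_one

end Unramified

end KZ

end

theorem mainTheorem7_general {p q g n e : ℕ} {K : Type} [NontriviallyNormedField K]
    [IsUltrametricDist K] [CompleteSpace K] (hp : p.Prime) (hp0 : (p : K) ≠ 0)
    (hp1 : ‖(p : K)‖ < 1) (hqP : q ∣ p ^ e - 1) (hg : 0 < g) (hgP : g ≤ p ^ e)
    (hn : n ≤ (g + 1) * q) (hc : 2 ≤ (p ^ e - 1) / q) :
    (∀ s : ℕ, 1 ≤ s → ∀ a ∈ KZ.ordinaryLocus K (KZ.hasseWitt n g p q e 1),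
      ‖(KZ.matEval (KZ.hasseWitt n g p q e s) a).det‖ = 1) ∧
    ∃ (A' : Fin n → (Fin n → K) → Matrix (Fin g) (Fin g) K)
      (J : (Fin n → K) → Matrix (Fin n) (Fin g) K)
      (J' : Fin n → (Fin n → K) → Matrix (Fin n) (Fin g) K),
      (∀ i,
        TendstoUniformlyOn
          (fun (s : ℕ) a => KZ.matEval (KZ.matPDeriv i (KZ.hasseWitt n g p q e s)) a *
            (KZ.matEval (KZ.hasseWitt n g p q e s) a)⁻¹)
          (A' i) Filter.atTop (KZ.ordinaryLocus K (KZ.hasseWitt n g p q e 1)) ∧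
        KZ.AnalyticOnUnitPolydiscs (KZ.ordinaryLocus K (KZ.hasseWitt n g p q e 1)) (A' i)) ∧
      (TendstoUniformlyOn
          (fun (s : ℕ) a => KZ.matEval (KZ.solMatrix n g p q e s) a *
            (KZ.matEval (KZ.hasseWitt n g p q e s) a)⁻¹)
          J Filter.atTop (KZ.ordinaryLocus K (KZ.hasseWitt n g p q e 1)) ∧
        KZ.AnalyticOnUnitPolydiscs (KZ.ordinaryLocus K (KZ.hasseWitt n g p q e 1)) J) ∧
      (∀ i,
        TendstoUniformlyOn
          (fun (s : ℕ) a => KZ.matEval (KZ.matPDeriv i (KZ.solMatrix n g p q e s)) a *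
            (KZ.matEval (KZ.hasseWitt n g p q e s) a)⁻¹)
          (J' i) Filter.atTop (KZ.ordinaryLocus K (KZ.hasseWitt n g p q e 1)) ∧
        KZ.AnalyticOnUnitPolydiscs (KZ.ordinaryLocus K (KZ.hasseWitt n g p q e 1)) (J' i)) ∧
      (∀ i, ∀ a ∈ KZ.ordinaryLocus K (KZ.hasseWitt n g p q e 1), ∀ k l,
        HasDerivAt (fun t => J (Function.update a i t) k l)
          ((J' i a - J a * A' i a) k l) (a i)) := by
  have he : 0 < e := Nat.pos_of_ne_zero fun h => by simp [h] at hc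
  have hF := KZ.natDegree_masterPoly_one_le hqP hn
  have hA := fun s => KZ.hasseWitt_eq_coeffMatrix (n := n) hqP hgP (s := s)
  have hdet : ∀ s, 1 ≤ s → ∀ a ∈ KZ.ordinaryLocus K (KZ.hasseWitt n g p q e 1),
      ‖(KZ.matEval (KZ.hasseWitt n g p q e s) a).det‖ = 1 := fun s hs a ha => by
    rw [hA 1 le_rfl] at ha
    rw [hA s hs]
    exact KZ.norm_det_matEval_coeffMatrix hp hp0 hp1 hF ha hs
  have limA := fun i => (KZ.isDworkFamily_matPDeriv_hasseWitt hp.pos he hqP hgP hn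
    (one_le_two.trans hc) i).exists_analytic_limit hp he hp0 hp1 hF hA
  obtain ⟨J, hJ⟩ := (KZ.isDworkFamily_solMatrix hp.pos hqP hg hgP hn
    (one_le_two.trans hc)).exists_analytic_limit hp he hp0 hp1 hF hA
  have limJ' := fun i => (KZ.isDworkFamily_matPDeriv_solMatrix hp.pos he hqP hg hgP hn hc
    i).exists_analytic_limit hp he hp0 hp1 hF hA
  choose A' hA' using limA
  choose J' hJ' using limJ'
  exact ⟨hdet, A', J, J', hA', hJ, hJ', fun i a ha k l =>
    KZ.hasDerivAt_update_of_tendstoUniformlyOn (fun s hs b hb => ⟨hb.1, hdet s hs b hb⟩)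
      hJ.1 (hJ' i).1 (hA' i).1 ha k l⟩

theorem mainTheorem7 (p q g n e m : ℕ) [Fact p.Prime] (hq : q.Prime) (hqp : q < p)
    (he : IsLeast {k : ℕ | 0 < k ∧ p ^ k ≡ 1 [MOD q]} e)
    (hg : 0 < g) (hn : n = g * q + 1) (hne : n < p ^ e) (hpn : n + q - 2 ≤ p) (hm : 0 < m) :
    -- the entries of all matrices below are rational functions regular on the domain
    (∀ s : ℕ, 1 ≤ s → ∀ a ∈ KZ.domain n g p q e m,
      ‖(KZ.matEval (KZ.hasseWitt n g p q e s) a).det‖ = 1) ∧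
    ∃ (A' : Fin n → (Fin n → KZ.unramifiedExt p m) →
          Matrix (Fin g) (Fin g) (KZ.unramifiedExt p m))
      (J : (Fin n → KZ.unramifiedExt p m) → Matrix (Fin n) (Fin g) (KZ.unramifiedExt p m))
      (J' : Fin n → (Fin n → KZ.unramifiedExt p m) →
          Matrix (Fin n) (Fin g) (KZ.unramifiedExt p m)),
      (∀ i,
        TendstoUniformlyOn
          (fun (s : ℕ) a => KZ.matEval (KZ.matPDeriv i (KZ.hasseWitt n g p q e s)) a *
            (KZ.matEval (KZ.hasseWitt n g p q e s) a)⁻¹)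
          (A' i) Filter.atTop (KZ.domain n g p q e m) ∧
        KZ.AnalyticOnUnitPolydiscs (KZ.domain n g p q e m) (A' i)) ∧
      (TendstoUniformlyOn
          (fun (s : ℕ) a => KZ.matEval (KZ.solMatrix n g p q e s) a *
            (KZ.matEval (KZ.hasseWitt n g p q e s) a)⁻¹)
          J Filter.atTop (KZ.domain n g p q e m) ∧
        KZ.AnalyticOnUnitPolydiscs (KZ.domain n g p q e m) J) ∧
      (∀ i,
        TendstoUniformlyOn
          (fun (s : ℕ) a => KZ.matEval (KZ.matPDeriv i (KZ.solMatrix n g p q e s)) a *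
            (KZ.matEval (KZ.hasseWitt n g p q e s) a)⁻¹)
          (J' i) Filter.atTop (KZ.domain n g p q e m) ∧
        KZ.AnalyticOnUnitPolydiscs (KZ.domain n g p q e m) (J' i)) ∧
      -- the partial derivative of each entry of `J` with respect to the `i`-th variable
      (∀ i, ∀ a ∈ KZ.domain n g p q e m, ∀ k l,
        HasDerivAt (fun t => J (Function.update a i t) k l)
          ((J' i a - J a * A' i a) k l) (a i)) := by
  subst hn
  have hp : p.Prime := Fact.out
  have hqP : q ∣ p ^ e - 1 := (Nat.modEq_iff_dvd' (Nat.one_le_pow e p hp.pos)).1 he.1.2.symm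
  have hq0 : 0 < q := hq.pos
  have hgq : 1 * q ≤ g * q := Nat.mul_le_mul_right q hg
  have hgg : g * 1 ≤ g * q := Nat.mul_le_mul_left g hq0
  have hc : 1 < (p ^ e - 1) / q := (Nat.lt_div_iff_mul_lt' hqP 1).2 (by omega)
  have := KZ.completeSpace_unramifiedExt p m (Nat.one_lt_pow hm.ne' hp.one_lt)
  exact mainTheorem7_general hp (by simpa using hp.ne_zero)
    (KZ.norm_natCast_unramifiedExt_lt_one p m) hqP hg (by omega) (by rw [Nat.succ_mul]; omega) hc
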